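/- Let $\mathcal A$ be a complex $2\times4$ matrix, let $|A_{ij}|$ be the determinant of its $i$-th and $j$-th columns, and assume that the boundary condition $bc$ given by $$\mathcal A\,\bigl(y_1(0),\,y_1(\pi),\,y_2(0),\,y_2(\pi)\bigr)^{t}=0$$ is regular, i.e. $|A_{14}|\ne0$ and $|A_{23}|\neq 0$. Let $P,Q\in L^2([0,\pi])$, let $V(y_1,y_2)=(Py_2,Qy_1)$, and let $L$ be the operator $Ly=(iy_1'+Py_2,\,-iy_2'+Qy_1)$ in $L^2([0,\pi],\mathbb C^2)$ whose domain consists of all absolutely continuous $y=(y_1,y_2)$ with $y'\in L^2$ that satisfy $bc$; let $L^0$ be the same operator with $P=Q=0$. Put $R_\lambda=(\lambda-L)^{-1}$, $R^0_\lambda=(\lambda-L^0)^{-1}$. Let $\tau_1,\tau_2\in\mathbb C$ be such that $e^{i\pi\tau_1},e^{i\pi\tau_2}$ are the two roots (with multiplicity) of $$|A_{14}|z^2+(|A_{13}|+|A_{24}|)z+|A_{23}|=0$$ and $|\mathrm{Re}\,\tau_1-\mathrm{Re}\,\tau_2|\le1$. For even $N\ge0$ and $T>0$ let $$R_{NT}=\Bigl\{x+it:\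 \bigl|x-\mathrm{Re}\tfrac{\tau_1+\tau_2}2\bigr|<N+1,\ |t|<T\Bigr\}$$ and define (with counterclockwise orientation of $\partial R_{NT}$) $$S_N=\frac1{2\pi i}\int_{\partial R_{NT}}R_\lambda\,d\lambda,\qquad S_N^0=\frac1{2\pi i}\int_{\partial R_{NT}}R^0_\lambda\,d\lambda,$$ $$A_N=\frac1{2\pi i}\int_{\partial R_{NT}}R^0_\lambda VR^0_\lambda\,d\lambda,\qquad B_N=\frac1{2\pi i}\int_{\partial R_{NT}}\sum_{m=2}^\infty R^0_\lambda(VR^0_\lambda)^m\,d\lambda .$$ Then there are $N_0\in\mathbb N$ and $T_0>0$ such that for all even $N\ge N_0$ and all $T\ge T_0$ the contour $\partial R_{NT}$ lies in the resolvent sets of $L$ and $L^0$, and for every $F\in L^2([0,\pi],\mathbb C^2)$ the series for $B_NF$ converges at each point of the contour, the four integrands applied to $F$ are continuous there, $S_NF$, $S^0_NF$, $A_NF$, $B_NF$ do not depend on $T\ge T_0$, and $S_NF-S_N^0F=A_NF+B_NF$. Moreover, with $\|(y_1,y_2)\|_\infty=\max(\|y_1\|_\infty,\|y_2\|_\infty)$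 and $N$ running through the even numbers, for every $F\in L^2([0,\pi],\mathbb C^2)$ $$\|B_NF\|_\infty\to0\quad\text{as }N\to\infty,$$ and consequently $$\|(S_N-S_N^0)F\|_\infty\to0\iff\|A_NF\|_\infty\to0 .$$ -/

import Mathlib

open MeasureTheory Filter Topology

noncomputable section

/-- Lebesgue measure on `[0, π]`. -/
abbrev diracMeasure : Measure ℝ := volume.restrict (Set.Icc 0 Real.pi)

/-- The space `L²([0, π], ℂ²)`. A constant factor in the scalar product changes neither the
topology nor any of the notions below. -/
abbrev DiracL2 : Type := Lp (EuclideanSpace ℂ (Fin 2)) 2 diracMeasure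

/-- `‖(y₁, y₂)‖_∞ = max (‖y₁‖_∞, ‖y₂‖_∞)`, with value `⊤` when the function is not essentially
bounded. -/
def diracSupNorm (u : DiracL2) : ENNReal :=
  max (eLpNorm (fun x => u x 0) ⊤ diracMeasure) (eLpNorm (fun x => u x 1) ⊤ diracMeasure)

/-- A boundary condition is given by a `2 × 4` matrix whose columns are the coefficients of
`y₁ 0`, `y₁ π`, `y₂ 0`, `y₂ π`, in this order. -/
def SatisfiesBC (A : Matrix (Fin 2) (Fin 4) ℂ) (y₁ y₂ : ℝ → ℂ) : Prop :=
  ∀ i : Fin 2, A i 0 * y₁ 0 + A i 1 * y₁ Real.pi + A i 2 * y₂ 0 + A i 3 * y₂ Real.pi = 0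

/-- The determinant of the `2 × 2` matrix formed by the columns `i` and `j` (numbered from `0`). -/
def bcMinor (A : Matrix (Fin 2) (Fin 4) ℂ) (i j : Fin 4) : ℂ :=
  (A.submatrix id ![i, j]).det

/-- Regular boundary conditions: the minors formed by the first and fourth columns, and by the
second and third columns, do not vanish. -/
def IsRegularBC (A : Matrix (Fin 2) (Fin 4) ℂ) : Prop :=
  bcMinor A 0 3 ≠ 0 ∧ bcMinor A 1 2 ≠ 0

/-- `exp (iπτ₁)` and `exp (iπτ₂)` are the roots, with multiplicity, of the characteristic
polynomial of the free operator, and `|Re τ₁ - Re τ₂| ≤ 1`. In the case of a double root this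
forces `τ₁ = τ₂`. -/
def IsCharExponents (A : Matrix (Fin 2) (Fin 4) ℂ) (τ₁ τ₂ : ℂ) : Prop :=
  (∀ z : ℂ, bcMinor A 0 3 * z ^ 2 + (bcMinor A 0 2 + bcMinor A 1 3) * z + bcMinor A 1 2 =
    bcMinor A 0 3 * (z - Complex.exp (Complex.I * Real.pi * τ₁)) *
      (z - Complex.exp (Complex.I * Real.pi * τ₂))) ∧
  |τ₁.re - τ₂.re| ≤ 1

/-- The graph of the Dirac operator `L_bc(v)`, `v = (0 P; Q 0)`: the class `u` has an absolutely
continuous representative `(y₁, y₂)` with derivatives in `L²` that satisfies the boundary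
condition, and `f = (i y₁' + P y₂, -i y₂' + Q y₁)`. -/
def DiracGraph (A : Matrix (Fin 2) (Fin 4) ℂ) (P Q : ℝ → ℂ) (u f : DiracL2) : Prop :=
  ∃ y₁ y₂ : ℝ → ℂ,
    AbsolutelyContinuousOnInterval y₁ 0 Real.pi ∧
    AbsolutelyContinuousOnInterval y₂ 0 Real.pi ∧
    MemLp (deriv y₁) 2 diracMeasure ∧ MemLp (deriv y₂) 2 diracMeasure ∧
    SatisfiesBC A y₁ y₂ ∧
    (∀ᵐ x ∂diracMeasure, u x 0 = y₁ x ∧ u x 1 = y₂ x) ∧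
    (∀ᵐ x ∂diracMeasure,
      f x 0 = Complex.I * deriv y₁ x + P x * y₂ x ∧
      f x 1 = -Complex.I * deriv y₂ x + Q x * y₁ x)

/-- The bounded operator `R` is `(lam - L_bc(v))⁻¹`: for every `g`, the element `R g` is the one
and only `u` in the domain with `lam u - L_bc(v) u = g`. -/
def IsDiracResolvent (A : Matrix (Fin 2) (Fin 4) ℂ) (P Q : ℝ → ℂ) (lam : ℂ)
    (R : DiracL2 →L[ℂ] DiracL2) : Prop :=
  ∀ g u : DiracL2, R g = u ↔ DiracGraph A P Q u (lam • u - g)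

/-- The resolvent set of `L_bc(v)`. -/
def diracResolventSet (A : Matrix (Fin 2) (Fin 4) ℂ) (P Q : ℝ → ℂ) : Set ℂ :=
  {lam | ∃ R : DiracL2 →L[ℂ] DiracL2, IsDiracResolvent A P Q lam R}

open Classical in
/-- The resolvent `(lam - L_bc(v))⁻¹` (zero outside of the resolvent set). -/
def diracResolvent (A : Matrix (Fin 2) (Fin 4) ℂ) (P Q : ℝ → ℂ) (lam : ℂ) :
    DiracL2 →L[ℂ] DiracL2 :=
  if h : ∃ R : DiracL2 →L[ℂ] DiracL2, IsDiracResolvent A P Q lam R then h.choose else 0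

/-- The resolvent of the free operator, `v = 0`. -/
def freeResolvent (A : Matrix (Fin 2) (Fin 4) ℂ) (lam : ℂ) : DiracL2 →L[ℂ] DiracL2 :=
  diracResolvent A 0 0 lam

open Classical in
/-- The multiplication operator `V (u₁, u₂) = (P u₂, Q u₁)` on its maximal domain
`{u ∈ L² | V u ∈ L²}`, which contains all bounded functions when `P` and `Q` are in `L²`
(zero outside of this domain). -/
def potentialMul (P Q : ℝ → ℂ) (u : DiracL2) : DiracL2 :=
  if h : MemLp (fun x => !₂[P x * u x 1, Q x * u x 0]) 2 diracMeasure then h.toLp else 0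

/-- The term `R⁰ (V R⁰)ᵐ F` of the perturbation series at the point `lam`. -/
def perturbTerm (A : Matrix (Fin 2) (Fin 4) ℂ) (P Q : ℝ → ℂ) (lam : ℂ) (m : ℕ)
    (F : DiracL2) : DiracL2 :=
  freeResolvent A lam ((fun G => potentialMul P Q (freeResolvent A lam G))^[m] F)

/-- The sum of the terms of order at least two, `∑_{m ≥ 2} R⁰ (V R⁰)ᵐ F`. -/
def nonlinearTail (A : Matrix (Fin 2) (Fin 4) ℂ) (P Q : ℝ → ℂ) (lam : ℂ)
    (F : DiracL2) : DiracL2 :=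
  ∑' m : ℕ, perturbTerm A P Q lam (m + 2) F

/-- The abscissa `Re ((τ₁ + τ₂) / 2)` of the centre of the contour. -/
def contourCentre (τ₁ τ₂ : ℂ) : ℝ := ((τ₁ + τ₂) / 2).re

/-- The open rectangle `R_{NT}`. -/
def contourRect (τ₁ τ₂ : ℂ) (N : ℕ) (T : ℝ) : Set ℂ :=
  {z | |z.re - contourCentre τ₁ τ₂| < N + 1 ∧ |z.im| < T}

/-- `(1 / 2πi) ∫ f(z) dz` over the boundary of `R_{NT}`, counterclockwise. The four integrals are
over the lower, upper, right and left side. -/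
def contourIntegral (τ₁ τ₂ : ℂ) (N : ℕ) (T : ℝ) (f : ℂ → DiracL2) : DiracL2 :=
  (2 * Real.pi * Complex.I : ℂ)⁻¹ •
    ((∫ x : ℝ in (contourCentre τ₁ τ₂ - (N + 1))..(contourCentre τ₁ τ₂ + (N + 1)),
        f (x + (-T : ℝ) * Complex.I)) -
      (∫ x : ℝ in (contourCentre τ₁ τ₂ - (N + 1))..(contourCentre τ₁ τ₂ + (N + 1)),
        f (x + (T : ℝ) * Complex.I)) +
      Complex.I • (∫ t : ℝ in (-T)..T,
        f ((contourCentre τ₁ τ₂ + (N + 1) : ℝ) + t * Complex.I)) -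
      Complex.I • (∫ t : ℝ in (-T)..T,
        f ((contourCentre τ₁ τ₂ - (N + 1) : ℝ) + t * Complex.I)))

/-- `S_N F`, the contour integral of the resolvent of `L_bc(v)`; the choice `P = Q = 0` gives
`S⁰_N F`. -/
def partialSum (A : Matrix (Fin 2) (Fin 4) ℂ) (P Q : ℝ → ℂ) (τ₁ τ₂ : ℂ) (N : ℕ) (T : ℝ)
    (F : DiracL2) : DiracL2 :=
  contourIntegral τ₁ τ₂ N T (fun lam => diracResolvent A P Q lam F)

/-- `A_N F`, the contour integral of `R⁰ V R⁰ F`. -/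
def linearPart (A : Matrix (Fin 2) (Fin 4) ℂ) (P Q : ℝ → ℂ) (τ₁ τ₂ : ℂ) (N : ℕ) (T : ℝ)
    (F : DiracL2) : DiracL2 :=
  contourIntegral τ₁ τ₂ N T (fun lam => perturbTerm A P Q lam 1 F)

/-- `B_N F`, the contour integral of `∑_{m ≥ 2} R⁰ (V R⁰)ᵐ F`. -/
def nonlinearPart (A : Matrix (Fin 2) (Fin 4) ℂ) (P Q : ℝ → ℂ) (τ₁ τ₂ : ℂ) (N : ℕ) (T : ℝ)
    (F : DiracL2) : DiracL2 :=
  contourIntegral τ₁ τ₂ N T (fun lam => nonlinearTail A P Q lam F)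

end

noncomputable section

/-! Let `K` be the free resolvent, regarded as an operator from `L²` into pairs of continuous
functions, and put `W = K V`. On continuous pairs `V` is bounded into `L²`, so the equation `lam y -
L y = g` becomes `y = K (g + V y)` (`diracGraph_iff`), and the resolvent of `L` is `(1 - W)⁻¹ K`
followed by the inclusion into `L²`. Since `(1 - W)⁻¹ = 1 + W + (1 - W)⁻¹ W²`, the splitting into
free, linear and nonlinear parts already holds for the integrands. What has to be shown is that the
contour integral of `(1 - W)⁻¹ W² K F` tends to zero in the maximum norm.

All estimates are made at a definite distance from the free spectrum, on `freeRegion`. Write `t = Im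
lam`.

Decay: Cauchy-Schwarz in Duhamel's formula, with each component integrated in the direction in which
its exponential decays, gives `‖K‖ = O((1 + |t|)^(-1/2))` (`exists_apriori`,
`exists_solutionOperator_bound`). Hence `‖W²‖ = O((1 + |t|)⁻¹)`. This makes the integrand integrable
along vertical lines, but not small.

Smallness: `‖W²‖ → 0` as `|lam| → ∞` (`kernelOp_sq_small`). For smooth potentials `V` exchanges the
components, whose rates `-i lam` and `i lam` are opposite; this nonresonance gains a factor `1 /
lam` (`exists_commutator_bound`). General potentials follow by density.

Interpolating between the two bounds gives `‖W²‖ ≤ ε^(1/4) (k / (1 + |t|))^(3/4)`. Together with the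
decay of `K` the integrand is at most a small constant times `(1 + |t|)^(-5/4)`, which is still
integrable (`exists_tailFun_bound`). So the vertical sides contribute little, uniformly in the
height, and the horizontal sides vanish as the height grows. The integrals do not depend on the
height because the integrands are holomorphic far from the real axis, so this proves the limit for
every fixed `T`. -/

/-! ### Duhamel's formula and absolutely continuous solutions -/

/-- The `L²` norm of a function on `[0, π]`, as a real number. -/
def diracNorm (f : ℝ → ℂ) : ℝ := (eLpNorm f 2 diracMeasure).toReal

/-- Duhamel's form of the equation `y' = ν y + f` on `[0, π]`. -/
def IsMildSolution (ν : ℂ) (f y : ℝ → ℂ) : Prop :=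
  ∀ x ∈ Set.Icc 0 Real.pi,
    y x = Complex.exp (ν * x) * (y 0 + ∫ s in (0 : ℝ)..x, Complex.exp (-ν * s) * f s)

lemma diracNorm_nonneg (f : ℝ → ℂ) : 0 ≤ diracNorm f := ENNReal.toReal_nonneg

lemma uIcc_zero_pi : Set.uIcc 0 Real.pi = Set.Icc 0 Real.pi := Set.uIcc_of_le Real.pi_pos.le

lemma memLp_intervalIntegrable {f : ℝ → ℂ} (hf : MemLp f 2 diracMeasure) :
    IntervalIntegrable f volume 0 Real.pi := by
  rw [intervalIntegrable_iff_integrableOn_Icc_of_le Real.pi_pos.le]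
  exact hf.integrable (by norm_num)

lemma intervalIntegrable_sub {f : ℝ → ℂ} (hf : IntervalIntegrable f volume 0 Real.pi)
    {a b : ℝ} (ha : a ∈ Set.Icc 0 Real.pi) (hb : b ∈ Set.Icc 0 Real.pi) :
    IntervalIntegrable f volume a b := by
  apply hf.mono_set
  rw [uIcc_zero_pi]
  exact Set.uIcc_subset_Icc ha hb

lemma intervalIntegrable_exp_mul {f : ℝ → ℂ} (hf : IntervalIntegrable f volume 0 Real.pi)
    (ν : ℂ) : IntervalIntegrable (fun s : ℝ => Complex.exp (ν * s) * f s) volume 0 Real.pi :=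
  hf.continuousOn_mul (by fun_prop)

lemma absolutelyContinuous_exp (ν : ℂ) :
    AbsolutelyContinuousOnInterval (fun x : ℝ => Complex.exp (ν * x)) 0 Real.pi := by
  apply ContDiffOn.absolutelyContinuousOnInterval
  apply ContDiff.contDiffOn
  have : ContDiff ℝ 1 (fun x : ℝ => (x : ℂ)) := Complex.ofRealCLM.contDiff
  fun_prop

lemma hasDerivAt_exp_mul_ofReal (ν : ℂ) (x : ℝ) :
    HasDerivAt (fun x : ℝ => Complex.exp (ν * x)) (ν * Complex.exp (ν * x)) x := by
  have h : HasDerivAt (fun z : ℂ => Complex.exp (ν * z)) (Complex.exp (ν * x) * (ν * 1)) (x : ℂ) :=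
    ((hasDerivAt_id _).const_mul ν).cexp
  convert h.comp_ofReal using 1
  ring

lemma ae_diracMeasure_iff {p : ℝ → Prop} :
    (∀ᵐ x ∂diracMeasure, p x) ↔ ∀ᵐ x : ℝ, x ∈ Set.Icc 0 Real.pi → p x :=
  ae_restrict_iff' measurableSet_Icc

lemma absolutelyContinuous_ae_differentiableAt {y : ℝ → ℂ}
    (hy : AbsolutelyContinuousOnInterval y 0 Real.pi) :
    ∀ᵐ x ∂diracMeasure, DifferentiableAt ℝ y x := by
  rw [ae_diracMeasure_iff, ← uIcc_zero_pi]
  exact hy.boundedVariationOn.ae_differentiableAt_of_mem_uIcc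

lemma AbsolutelyContinuousOnInterval.mul_complex {f g : ℝ → ℂ} {a b : ℝ}
    (hf : AbsolutelyContinuousOnInterval f a b) (hg : AbsolutelyContinuousOnInterval g a b) :
    AbsolutelyContinuousOnInterval (fun x => f x * g x) a b :=
  hf.fun_smul hg

lemma AbsolutelyContinuousOnInterval.congr_on {f g : ℝ → ℂ}
    (hf : AbsolutelyContinuousOnInterval f 0 Real.pi) (h : ∀ x ∈ Set.Icc 0 Real.pi, f x = g x) :
    AbsolutelyContinuousOnInterval g 0 Real.pi := by
  rw [absolutelyContinuousOnInterval_iff] at hf ⊢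
  intro ε hε
  obtain ⟨δ, hδ, hE⟩ := hf ε hε
  refine ⟨δ, hδ, fun E hEm hEs => ?_⟩
  convert hE E hEm hEs using 3 with i hi
  · exact (h _ (uIcc_zero_pi ▸ (hEm.1 i hi).1)).symm
  · exact (h _ (uIcc_zero_pi ▸ (hEm.1 i hi).2)).symm

lemma absolutelyContinuous_integral {f : ℝ → ℂ} (hf : IntervalIntegrable f volume 0 Real.pi) :
    AbsolutelyContinuousOnInterval (fun x => ∫ s in (0 : ℝ)..x, f s) 0 Real.pi := by
  have hre : IntervalIntegrable (fun s => (f s).re) volume 0 Real.pi := ⟨hf.1.re, hf.2.re⟩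
  have him : IntervalIntegrable (fun s => (f s).im) volume 0 Real.pi := ⟨hf.1.im, hf.2.im⟩
  have hc : ∀ c : ℂ, AbsolutelyContinuousOnInterval (fun _ : ℝ => c) 0 Real.pi := fun c =>
    ContDiffOn.absolutelyContinuousOnInterval contDiffOn_const
  refine AbsolutelyContinuousOnInterval.congr_on (((hre.absolutelyContinuousOnInterval_intervalIntegral
    Set.left_mem_uIcc).fun_smul (hc 1)).fun_add
    ((him.absolutelyContinuousOnInterval_intervalIntegral Set.left_mem_uIcc).fun_smul
      (hc Complex.I))) fun x hx => ?_
  have hi := intervalIntegrable_sub hf ⟨le_rfl, Real.pi_pos.le⟩ hx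
  have h1 := Complex.reCLM.intervalIntegral_comp_comm hi
  have h2 := Complex.imCLM.intervalIntegral_comp_comm hi
  simp only [Complex.reCLM_apply, Complex.imCLM_apply] at h1 h2
  rw [h1, h2]
  simp

lemma ae_hasDerivAt_integral_zero {f : ℝ → ℂ} (hf : IntervalIntegrable f volume 0 Real.pi) :
    ∀ᵐ x ∂diracMeasure, HasDerivAt (fun x => ∫ s in (0 : ℝ)..x, f s) (f x) x := by
  rw [ae_diracMeasure_iff]
  filter_upwards [hf.ae_hasDerivAt_integral] with x h hx
  exact h (uIcc_zero_pi ▸ hx) 0 Set.left_mem_uIcc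

/-- Integrating factor: `exp (-ν x) y x` minus the Duhamel integral is absolutely continuous with
derivative zero almost everywhere, hence constant. -/
theorem isMildSolution_of_absolutelyContinuous {ν : ℂ} {f y : ℝ → ℂ}
    (hf : IntervalIntegrable f volume 0 Real.pi)
    (hy : AbsolutelyContinuousOnInterval y 0 Real.pi)
    (hd : ∀ᵐ x ∂diracMeasure, deriv y x = ν * y x + f x) : IsMildSolution ν f y := by
  have hi := intervalIntegrable_exp_mul hf (-ν)
  set F : ℝ → ℂ := fun x => ∫ s in (0 : ℝ)..x, Complex.exp (-ν * s) * f s with hF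
  have hac : AbsolutelyContinuousOnInterval
      (fun x : ℝ => Complex.exp (-ν * x) * y x - F x) 0 Real.pi :=
    ((absolutelyContinuous_exp (-ν)).mul_complex hy).fun_sub (absolutelyContinuous_integral hi)
  have hder : ∀ᵐ x ∂diracMeasure,
      HasDerivAt (fun x : ℝ => Complex.exp (-ν * x) * y x - F x) 0 x := by
    filter_upwards [absolutelyContinuous_ae_differentiableAt hy, hd,
      ae_hasDerivAt_integral_zero hi] with x h1 h2 h3
    refine (((hasDerivAt_exp_mul_ofReal (-ν) x).mul h1.hasDerivAt).sub h3).congr_deriv ?_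
    rw [h2]
    ring
  rw [ae_diracMeasure_iff, ← uIcc_zero_pi] at hder
  obtain ⟨C, hC⟩ := hac.const_of_ae_hasDerivAt_zero hder
  intro x hx
  have h0 := hC 0 (by simp)
  have hx1 := hC x (by rw [uIcc_zero_pi]; exact hx)
  have hF0 : F 0 = 0 := by simp [hF]
  rw [← h0, hF0] at hx1
  simp only [Complex.ofReal_zero, mul_zero, Complex.exp_zero, one_mul, sub_zero] at hx1
  change y x = Complex.exp (ν * x) * (y 0 + F x)
  rw [← hx1]
  have : Complex.exp (ν * x) * Complex.exp (-ν * x) = 1 := by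
    rw [← Complex.exp_add]; simp
  linear_combination (-(y x)) * this

lemma IsMildSolution.absolutelyContinuous {ν : ℂ} {f y : ℝ → ℂ}
    (hf : IntervalIntegrable f volume 0 Real.pi) (hy : IsMildSolution ν f y) :
    AbsolutelyContinuousOnInterval y 0 Real.pi := by
  have hi := intervalIntegrable_exp_mul hf (-ν)
  have hc : AbsolutelyContinuousOnInterval (fun _ : ℝ => y 0) 0 Real.pi := by
    apply ContDiffOn.absolutelyContinuousOnInterval
    exact contDiffOn_const
  have h := (absolutelyContinuous_exp ν).mul_complex (hc.fun_add (absolutelyContinuous_integral hi))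
  exact h.congr_on fun x hx => (hy x hx).symm

lemma ae_mem_Ioo : ∀ᵐ x ∂diracMeasure, x ∈ Set.Ioo 0 Real.pi := by
  have h := ae_restrict_mem (μ := (volume : Measure ℝ)) (measurableSet_Ioo (a := 0) (b := Real.pi))
  rwa [Measure.restrict_congr_set Ioo_ae_eq_Icc] at h

lemma IsMildSolution.ae_hasDerivAt {ν : ℂ} {f y : ℝ → ℂ}
    (hf : IntervalIntegrable f volume 0 Real.pi) (hy : IsMildSolution ν f y) :
    ∀ᵐ x ∂diracMeasure, HasDerivAt y (ν * y x + f x) x := by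
  have hi := intervalIntegrable_exp_mul hf (-ν)
  filter_upwards [ae_mem_Ioo, ae_hasDerivAt_integral_zero hi] with x hx h4
  have h5 := (hasDerivAt_exp_mul_ofReal ν x).mul (h4.const_add (y 0))
  have h6 : y =ᶠ[𝓝 x] fun x => Complex.exp (ν * x) *
      (y 0 + ∫ s in (0 : ℝ)..x, Complex.exp (-ν * s) * f s) := by
    filter_upwards [Icc_mem_nhds hx.1 hx.2] with z hz using hy z hz
  refine HasDerivAt.congr_of_eventuallyEq (h5.congr_deriv ?_) h6
  have : Complex.exp (ν * x) * Complex.exp (-ν * x) = 1 := by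
    rw [← Complex.exp_add]; simp
  rw [hy x (Set.Ioo_subset_Icc_self hx)]
  linear_combination (f x) * this

/-- The base point is free, so that the integration can start at whichever endpoint makes the
exponential at most one in modulus. -/
lemma IsMildSolution.eq_shift {ν : ℂ} {f y : ℝ → ℂ}
    (hf : IntervalIntegrable f volume 0 Real.pi) (hy : IsMildSolution ν f y) {x₀ x : ℝ}
    (hx₀ : x₀ ∈ Set.Icc 0 Real.pi) (hx : x ∈ Set.Icc 0 Real.pi) :
    y x = Complex.exp (ν * (x - x₀)) * y x₀ +
      ∫ s in x₀..x, Complex.exp (ν * (x - s)) * f s := by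
  have hi := intervalIntegrable_exp_mul hf (-ν)
  have h0 : (0 : ℝ) ∈ Set.Icc 0 Real.pi := ⟨le_rfl, Real.pi_pos.le⟩
  have h1 := intervalIntegral.integral_add_adjacent_intervals
    (intervalIntegrable_sub hi h0 hx₀) (intervalIntegrable_sub hi hx₀ hx)
  have h2 : ∫ s in x₀..x, Complex.exp (ν * (x - s)) * f s =
      Complex.exp (ν * x) * ∫ s in x₀..x, Complex.exp (-ν * s) * f s := by
    rw [← intervalIntegral.integral_const_mul]
    congr 1
    ext s
    rw [← mul_assoc, ← Complex.exp_add]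
    ring_nf
  have h3 : Complex.exp (ν * (x - x₀)) * Complex.exp (ν * x₀) = Complex.exp (ν * x) := by
    rw [← Complex.exp_add]; ring_nf
  rw [hy x hx, h2, hy x₀ hx₀, ← h1, ← mul_assoc, h3]
  ring

/-! ### Decay of Duhamel integrals -/

/-- The decay rate of the free resolvent in the distance `t` to the real axis. -/
def decayRate (t : ℝ) : ℝ := √((Real.pi + 1) / (1 + |t|))

lemma decayRate_nonneg (t : ℝ) : 0 ≤ decayRate t := Real.sqrt_nonneg _

/-- The integral is at most `π`, because the integrand is at most one, and `|r|` times it is at most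
one, by the explicit primitive. Adding the two bounds gives the factor `1 + |r|`. -/
lemma integral_exp_uIoc_le {r x₀ x : ℝ} (hx₀ : x₀ ∈ Set.Icc 0 Real.pi)
    (hx : x ∈ Set.Icc 0 Real.pi) (hr : r * (x - x₀) ≤ 0) :
    ∫ s in Set.uIoc x₀ x, Real.exp (r * (x - s)) ^ 2 ≤ (Real.pi + 1) / (1 + |r|) := by
  have hle : ∀ s ∈ Set.uIoc x₀ x, Real.exp (r * (x - s)) ^ 2 ≤ 1 := by
    intro s hs
    have : r * (x - s) ≤ 0 := by
      rcases le_total x₀ x with h | h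
      · rw [Set.uIoc_of_le h] at hs
        rcases h.eq_or_lt with h | h
        · subst h; simp at hs
        · have : r ≤ 0 := by
            by_contra hc
            push Not at hc
            have := mul_pos hc (sub_pos.2 h)
            linarith
          exact mul_nonpos_of_nonpos_of_nonneg this (by linarith [hs.2])
      · rw [Set.uIoc_of_ge h] at hs
        rcases h.eq_or_lt with h | h
        · subst h; simp at hs
        · have : 0 ≤ r := by
            by_contra hc
            push Not at hc
            have := mul_pos_of_neg_of_neg hc (sub_neg.2 h)
            linarith
          exact mul_nonpos_of_nonneg_of_nonpos this (by linarith [hs.1])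
    have h1 := Real.exp_le_one_iff.2 this
    exact pow_le_one₀ (Real.exp_pos _).le h1
  have hcont : Continuous fun s : ℝ => Real.exp (r * (x - s)) ^ 2 := by fun_prop
  have hJ : ∫ s in Set.uIoc x₀ x, Real.exp (r * (x - s)) ^ 2 ≤ Real.pi := by
    have h1 : ∫ s in Set.uIoc x₀ x, Real.exp (r * (x - s)) ^ 2 ≤
        ∫ s in Set.uIoc x₀ x, (1 : ℝ) := by
      apply setIntegral_mono_on _ _ measurableSet_uIoc hle
      · exact (hcont.integrableOn_uIcc).mono_set Set.uIoc_subset_uIcc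
      · exact (continuous_const.integrableOn_uIcc).mono_set Set.uIoc_subset_uIcc
    refine h1.trans ?_
    simp only [integral_const, smul_eq_mul, mul_one, Set.uIoc]
    rw [measureReal_restrict_apply_univ, Real.volume_real_Ioc, max_sub_min_eq_abs]
    refine max_le (abs_le.2 ⟨?_, ?_⟩) Real.pi_pos.le <;> linarith [hx.1, hx.2, hx₀.1, hx₀.2]
  have hrJ : |r| * ∫ s in Set.uIoc x₀ x, Real.exp (r * (x - s)) ^ 2 ≤ 1 := by
    have hn : 0 ≤ ∫ s in Set.uIoc x₀ x, Real.exp (r * (x - s)) ^ 2 :=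
      setIntegral_nonneg measurableSet_uIoc fun s _ => by positivity
    have habs := intervalIntegral.abs_integral_eq_abs_integral_uIoc (μ := volume) (a := x₀) (b := x)
      (fun s : ℝ => Real.exp (r * (x - s)) ^ 2)
    rw [abs_of_nonneg hn] at habs
    rw [← habs, ← abs_mul, ← intervalIntegral.integral_const_mul]
    have hd : ∀ s ∈ Set.uIcc x₀ x, HasDerivAt (fun s : ℝ => -(1 / 2) * Real.exp (r * (x - s)) ^ 2)
        (r * Real.exp (r * (x - s)) ^ 2) s := by
      intro s _
      have h := (((((hasDerivAt_id s).const_sub x).const_mul r).exp).pow 2).const_mul (-(1 / 2) : ℝ)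
      refine h.congr_deriv ?_
      simp only [id]
      ring
    rw [intervalIntegral.integral_eq_sub_of_hasDerivAt hd
      ((continuous_const.mul hcont).intervalIntegrable _ _)]
    have h1 : Real.exp (r * (x - x₀)) ^ 2 ≤ 1 :=
      pow_le_one₀ (Real.exp_pos _).le (Real.exp_le_one_iff.2 hr)
    have h2 : 0 ≤ Real.exp (r * (x - x₀)) ^ 2 := by positivity
    rw [sub_self, mul_zero, Real.exp_zero, abs_le]
    constructor <;> linarith
  rw [le_div_iff₀ (by positivity)]
  linarith

lemma integral_norm_sq_le_diracNorm {f : ℝ → ℂ} (hf : MemLp f 2 diracMeasure) {s : Set ℝ}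
    (hs : s ⊆ Set.Icc 0 Real.pi) :
    (∫ x in s, ‖f x‖ ^ (2 : ℝ)) ^ (1 / (2 : ℝ)) ≤ diracNorm f := by
  have h1 : diracNorm f = (∫ x in Set.Icc 0 Real.pi, ‖f x‖ ^ (2 : ℝ)) ^ (1 / (2 : ℝ)) := by
    unfold diracNorm
    rw [hf.eLpNorm_eq_integral_rpow_norm (by norm_num) (by norm_num)]
    rw [ENNReal.toReal_ofReal (by positivity)]
    norm_num
  rw [h1]
  refine Real.rpow_le_rpow (by positivity) ?_ (by norm_num)
  refine setIntegral_mono_set ?_ (ae_of_all _ fun x => by positivity) (Eventually.of_forall hs)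
  have := hf.integrable_norm_rpow (by norm_num) (by norm_num)
  simpa [IntegrableOn] using this

/-- Cauchy-Schwarz. The sign condition `hr` says that the exponential does not grow from the base
point `x₀` to `x`. -/
theorem norm_duhamel_integral_le {ν : ℂ} {f : ℝ → ℂ} (hf : MemLp f 2 diracMeasure) {x₀ x : ℝ}
    (hx₀ : x₀ ∈ Set.Icc 0 Real.pi) (hx : x ∈ Set.Icc 0 Real.pi) (hr : ν.re * (x - x₀) ≤ 0) :
    ‖∫ s in x₀..x, Complex.exp (ν * (x - s)) * f s‖ ≤ decayRate ν.re * diracNorm f := by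
  have hsub : Set.uIoc x₀ x ⊆ Set.Icc 0 Real.pi :=
    Set.uIoc_subset_uIcc.trans (Set.uIcc_subset_Icc hx₀ hx)
  have hfr : MemLp f 2 (volume.restrict (Set.uIoc x₀ x)) :=
    hf.mono_measure (Measure.restrict_mono hsub le_rfl)
  have hcont : Continuous fun s : ℝ => Real.exp (ν.re * (x - s)) := by fun_prop
  refine (intervalIntegral.norm_integral_le_integral_norm_uIoc).trans ?_
  have h1 : ∀ s : ℝ, ‖Complex.exp (ν * (x - s)) * f s‖ = Real.exp (ν.re * (x - s)) * ‖f s‖ := by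
    intro s
    rw [norm_mul, Complex.norm_exp]
    congr 2
    rw [← Complex.ofReal_sub, Complex.re_mul_ofReal]
  simp_rw [h1]
  have hconj : (2 : ℝ).HolderConjugate 2 := Real.HolderConjugate.two_two
  have hex : MemLp (fun s : ℝ => Real.exp (ν.re * (x - s))) (ENNReal.ofReal 2)
      (volume.restrict (Set.uIoc x₀ x)) := by
    obtain ⟨C, hC⟩ := isCompact_uIcc.exists_bound_of_continuousOn (s := Set.uIcc x₀ x)
      hcont.continuousOn
    have : IsFiniteMeasure (volume.restrict (Set.uIoc x₀ x)) :=
      ⟨by simp [Set.uIoc]⟩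
    refine MemLp.of_bound hcont.aestronglyMeasurable C ?_
    filter_upwards [ae_restrict_mem measurableSet_uIoc] with s hs
    exact hC s (Set.uIoc_subset_uIcc hs)
  have hH := integral_mul_le_Lp_mul_Lq_of_nonneg (μ := volume.restrict (Set.uIoc x₀ x)) hconj
    (f := fun s : ℝ => Real.exp (ν.re * (x - s))) (g := fun s => ‖f s‖)
    (ae_of_all _ fun s => (Real.exp_pos _).le) (ae_of_all _ fun s => norm_nonneg _)
    hex (by simpa using hfr.norm)
  refine hH.trans ?_
  refine mul_le_mul ?_ (integral_norm_sq_le_diracNorm hf hsub) (by positivity) (decayRate_nonneg _)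
  rw [decayRate, Real.sqrt_eq_rpow]
  refine Real.rpow_le_rpow (by positivity) ?_ (by norm_num)
  have := integral_exp_uIoc_le hx₀ hx hr
  simpa using this

/-! ### A priori bounds for the free boundary value problem -/

/-- `(y₁, y₂)` solves `lam y - L⁰ y = (g₁, g₂)` with boundary data `d`. -/
def IsFreeSolution (A : Matrix (Fin 2) (Fin 4) ℂ) (lam : ℂ) (g₁ g₂ : ℝ → ℂ) (d : Fin 2 → ℂ)
    (y₁ y₂ : ℝ → ℂ) : Prop :=
  IsMildSolution (-Complex.I * lam) (fun x => Complex.I * g₁ x) y₁ ∧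
  IsMildSolution (Complex.I * lam) (fun x => -Complex.I * g₂ x) y₂ ∧
  ∀ i : Fin 2, A i 0 * y₁ 0 + A i 1 * y₁ Real.pi + A i 2 * y₂ 0 + A i 3 * y₂ Real.pi = d i

/-- The points at a definite distance from the spectrum of the free operator. -/
def freeRegion (τ₁ τ₂ : ℂ) : Set ℂ :=
  {lam | ∀ τ : ℂ, τ = τ₁ ∨ τ = τ₂ →
    1 / 2 ≤ ‖Complex.exp (Complex.I * Real.pi * (lam - τ)) - 1‖ ∧
    1 / 2 ≤ ‖Complex.exp (Complex.I * Real.pi * (τ - lam)) - 1‖}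

/-- The boundary matrix after the components `y₁` and `y₂` are exchanged. -/
def swapBC (A : Matrix (Fin 2) (Fin 4) ℂ) : Matrix (Fin 2) (Fin 4) ℂ :=
  A.submatrix id ![2, 3, 0, 1]

lemma bcMinor_eq (A : Matrix (Fin 2) (Fin 4) ℂ) (i j : Fin 4) :
    bcMinor A i j = A 0 i * A 1 j - A 0 j * A 1 i := by
  simp [bcMinor, Matrix.det_fin_two]

lemma IsRegularBC.swap {A : Matrix (Fin 2) (Fin 4) ℂ} (hA : IsRegularBC A) :
    IsRegularBC (swapBC A) := by
  obtain ⟨h1, h2⟩ := hA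
  rw [bcMinor_eq] at h1 h2
  refine ⟨?_, ?_⟩
  · rw [bcMinor_eq]
    simp only [swapBC, Matrix.submatrix_apply, id]
    intro h
    apply h2
    simp at h
    linear_combination -h
  · rw [bcMinor_eq]
    simp only [swapBC, Matrix.submatrix_apply, id]
    intro h
    apply h1
    simp at h
    linear_combination -h

/-- The exchange of components turns the characteristic polynomial `p z` into `-z² p (1 / z)`, whose
roots are the reciprocals. -/
lemma IsCharExponents.swap {A : Matrix (Fin 2) (Fin 4) ℂ} {τ₁ τ₂ : ℂ}
    (hτ : IsCharExponents A τ₁ τ₂) : IsCharExponents (swapBC A) (-τ₁) (-τ₂) := by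
  obtain ⟨h, hre⟩ := hτ
  refine ⟨fun z => ?_, ?_⟩
  · have h0 := h 0
    have h1 := h 1
    set a := Complex.exp (Complex.I * Real.pi * τ₁) with ha
    set b := Complex.exp (Complex.I * Real.pi * τ₂) with hb
    have ha0 : a ≠ 0 := Complex.exp_ne_zero _
    have hb0 : b ≠ 0 := Complex.exp_ne_zero _
    have ha' : Complex.exp (Complex.I * Real.pi * (-τ₁)) = a⁻¹ := by
      rw [ha, ← Complex.exp_neg]; ring_nf
    have hb' : Complex.exp (Complex.I * Real.pi * (-τ₂)) = b⁻¹ := by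
      rw [hb, ← Complex.exp_neg]; ring_nf
    rw [ha', hb']
    simp only [bcMinor_eq] at h0 h1 ⊢
    simp only [swapBC, Matrix.submatrix_apply, id]
    simp
    have hba : a * b * (a⁻¹ * b⁻¹) = 1 := by field_simp
    field_simp
    -- The values at `0` and `1` determine the lower coefficients (Vieta), which is all that is
    -- needed.
    linear_combination (-(a * b * z ^ 2 + a * b * z - (a * z - 1) * (b * z - 1)) + 2 * (a * b * z)) * h0 +
      (-a * b * z) * h1
  · rw [Complex.neg_re, Complex.neg_re, neg_sub_neg, abs_sub_comm]
    exact hre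

/-- The reflection interchanges the two inequalities in `freeRegion`; this is why both are imposed.
-/
lemma freeRegion_swap {τ₁ τ₂ lam : ℂ} (h : lam ∈ freeRegion τ₁ τ₂) :
    -lam ∈ freeRegion (-τ₁) (-τ₂) := by
  intro τ hτ
  have := h (-τ) (by rcases hτ with h | h <;> simp [h])
  rw [show -lam - τ = -τ - lam by ring, show τ - -lam = lam - -τ by ring]
  exact ⟨this.2, this.1⟩

lemma diracNorm_neg (f : ℝ → ℂ) : diracNorm (-f) = diracNorm f := by
  rw [diracNorm, eLpNorm_neg, diracNorm]

lemma diracNorm_const_mul (c : ℂ) (f : ℝ → ℂ) : diracNorm (fun x => c * f x) = ‖c‖ * diracNorm f := by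
  have : (fun x => c * f x) = c • f := rfl
  rw [diracNorm, this, eLpNorm_const_smul, ENNReal.toReal_mul]
  simp [diracNorm]

lemma IsFreeSolution.swap {A : Matrix (Fin 2) (Fin 4) ℂ} {lam : ℂ} {g₁ g₂ y₁ y₂ : ℝ → ℂ}
    {d : Fin 2 → ℂ} (h : IsFreeSolution A lam g₁ g₂ d y₁ y₂) :
    IsFreeSolution (swapBC A) (-lam) (fun x => -g₂ x) (fun x => -g₁ x) d y₂ y₁ := by
  obtain ⟨h1, h2, h3⟩ := h
  refine ⟨?_, ?_, fun i => ?_⟩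
  · convert h2 using 1
    · ring
    · ext x; ring
  · convert h1 using 1
    · ring
    · ext x; ring
  · have := h3 i
    simp only [swapBC, Matrix.submatrix_apply, id]
    simp
    linear_combination this

/-- Each factor `exp (iπ lam) - exp (iπτ)` is at least half of `|exp (iπτ)|`, which gives the `4` in
the denominator. -/
lemma norm_charDet_ge {A : Matrix (Fin 2) (Fin 4) ℂ} {τ₁ τ₂ : ℂ}
    (hτ : IsCharExponents A τ₁ τ₂) {lam : ℂ} (hl : lam ∈ freeRegion τ₁ τ₂) :
    ‖bcMinor A 0 3‖ * ‖Complex.exp (Complex.I * Real.pi * τ₁)‖ *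
        ‖Complex.exp (Complex.I * Real.pi * τ₂)‖ / 4 ≤
      ‖bcMinor A 0 3 * Complex.exp (Complex.I * Real.pi * lam) ^ 2 +
        (bcMinor A 0 2 + bcMinor A 1 3) * Complex.exp (Complex.I * Real.pi * lam) +
        bcMinor A 1 2‖ := by
  rw [hτ.1, norm_mul, norm_mul]
  have key : ∀ τ : ℂ, τ = τ₁ ∨ τ = τ₂ → ‖Complex.exp (Complex.I * Real.pi * τ)‖ / 2 ≤
      ‖Complex.exp (Complex.I * Real.pi * lam) - Complex.exp (Complex.I * Real.pi * τ)‖ := by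
    intro τ h
    have h1 := (hl τ h).1
    have h2 : Complex.exp (Complex.I * Real.pi * lam) - Complex.exp (Complex.I * Real.pi * τ) =
        Complex.exp (Complex.I * Real.pi * τ) *
          (Complex.exp (Complex.I * Real.pi * (lam - τ)) - 1) := by
      rw [mul_sub, ← Complex.exp_add]
      ring_nf
    rw [h2, norm_mul]
    have := mul_le_mul_of_nonneg_left h1 (norm_nonneg (Complex.exp (Complex.I * Real.pi * τ)))
    linarith
  have k1 := key τ₁ (Or.inl rfl)
  have k2 := key τ₂ (Or.inr rfl)
  have := mul_le_mul k1 k2 (by positivity) (by positivity)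
  have := mul_le_mul_of_nonneg_left this (norm_nonneg (bcMinor A 0 3))
  refine le_trans (le_of_eq ?_) (this.trans (le_of_eq ?_)) <;> ring

lemma diracNorm_I_mul (f : ℝ → ℂ) : diracNorm (fun x => Complex.I * f x) = diracNorm f := by
  rw [diracNorm_const_mul]; simp

lemma diracNorm_neg_I_mul (f : ℝ → ℂ) : diracNorm (fun x => -Complex.I * f x) = diracNorm f := by
  rw [diracNorm_const_mul]; simp

/-- In the upper half plane the good unknowns are `α = y₁ π` and `β = y₂ 0`: starting from these
ends, every exponential has modulus at most one. The boundary condition becomes a 2×2 system for `α`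
and `β` with bounded entries, and its determinant is the characteristic polynomial at `z = exp (iπ
lam)`, which is bounded below on `freeRegion`. Cramer's rule finishes the estimate. -/
theorem exists_apriori_of_im_nonneg {A : Matrix (Fin 2) (Fin 4) ℂ} (hA : IsRegularBC A)
    {τ₁ τ₂ : ℂ} (hτ : IsCharExponents A τ₁ τ₂) :
    ∃ C : ℝ, 0 ≤ C ∧ ∀ lam ∈ freeRegion τ₁ τ₂, 0 ≤ lam.im → ∀ (g₁ g₂ y₁ y₂ : ℝ → ℂ)
      (d : Fin 2 → ℂ), MemLp g₁ 2 diracMeasure → MemLp g₂ 2 diracMeasure →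
      IsFreeSolution A lam g₁ g₂ d y₁ y₂ → ∀ x ∈ Set.Icc 0 Real.pi,
        ‖y₁ x‖ ≤ C * (decayRate lam.im * (diracNorm g₁ + diracNorm g₂) + (‖d 0‖ + ‖d 1‖)) ∧
        ‖y₂ x‖ ≤ C * (decayRate lam.im * (diracNorm g₁ + diracNorm g₂) + (‖d 0‖ + ‖d 1‖)) := by
  set δ : ℝ := ‖bcMinor A 0 3‖ * ‖Complex.exp (Complex.I * Real.pi * τ₁)‖ *
        ‖Complex.exp (Complex.I * Real.pi * τ₂)‖ / 4 with hδ
  have hδ0 : 0 < δ := by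
    have := norm_pos_iff.2 hA.1
    have h1 := norm_pos_iff.2 (Complex.exp_ne_zero (Complex.I * Real.pi * τ₁))
    have h2 := norm_pos_iff.2 (Complex.exp_ne_zero (Complex.I * Real.pi * τ₂))
    positivity
  set S : ℝ := ∑ i, ∑ j, ‖A i j‖ with hS
  have hS0 : 0 ≤ S := by positivity
  have hAS : ∀ i j, ‖A i j‖ ≤ S := fun i j =>
    (Finset.single_le_sum (f := fun j => ‖A i j‖) (fun _ _ => norm_nonneg _)
      (Finset.mem_univ j)).trans
    (Finset.single_le_sum (f := fun i => ∑ j, ‖A i j‖)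
      (fun _ _ => Finset.sum_nonneg fun _ _ => norm_nonneg _) (Finset.mem_univ i))
  -- Cramer's rule: matrix entries at most `2 S`, right-hand sides at most `(1 + 2 S) B` in total,
  -- determinant at least `δ`. The final `1` absorbs the Duhamel term.
  refine ⟨2 * S / δ * (1 + 2 * S) + 1, by positivity, ?_⟩
  intro lam hlam him g₁ g₂ y₁ y₂ d hg₁ hg₂ hy x hx
  have h0 : (0 : ℝ) ∈ Set.Icc 0 Real.pi := ⟨le_rfl, Real.pi_pos.le⟩
  have hπ : Real.pi ∈ Set.Icc 0 Real.pi := ⟨Real.pi_pos.le, le_rfl⟩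
  obtain ⟨hy1, hy2, hbc⟩ := hy
  have hG₁ : MemLp (fun x => Complex.I * g₁ x) 2 diracMeasure := hg₁.const_mul _
  have hG₂ : MemLp (fun x => -Complex.I * g₂ x) 2 diracMeasure := hg₂.const_mul _
  set κ := decayRate lam.im with hκ
  have hre1 : (-Complex.I * lam).re = lam.im := by simp
  have hre2 : (Complex.I * lam).re = -lam.im := by simp
  have hκ2 : decayRate (-lam.im) = κ := by simp [hκ, decayRate]
  have hn1 := diracNorm_nonneg g₁
  have hn2 := diracNorm_nonneg g₂
  have hκ0 : 0 ≤ κ := decayRate_nonneg _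
  set α := y₁ Real.pi
  set β := y₂ 0
  have e1 : ∀ x ∈ Set.Icc 0 Real.pi, ∃ J : ℂ, ‖J‖ ≤ κ * diracNorm g₁ ∧
      y₁ x = Complex.exp (-Complex.I * lam * (x - Real.pi)) * α + J := by
    intro x hx
    refine ⟨_, ?_, hy1.eq_shift (memLp_intervalIntegrable hG₁) hπ hx⟩
    have := norm_duhamel_integral_le (ν := -Complex.I * lam) hG₁ hπ hx (by
      rw [hre1]; exact mul_nonpos_of_nonneg_of_nonpos him (by linarith [hx.2]))
    rwa [diracNorm_I_mul, hre1] at this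
  have e2 : ∀ x ∈ Set.Icc 0 Real.pi, ∃ J : ℂ, ‖J‖ ≤ κ * diracNorm g₂ ∧
      y₂ x = Complex.exp (Complex.I * lam * (x - (0 : ℝ))) * β + J := by
    intro x hx
    refine ⟨_, ?_, hy2.eq_shift (memLp_intervalIntegrable hG₂) h0 hx⟩
    have := norm_duhamel_integral_le (ν := Complex.I * lam) hG₂ h0 hx (by
      rw [hre2]; nlinarith [hx.1])
    rwa [diracNorm_neg_I_mul, hre2, hκ2] at this
  have b1 : ∀ x ∈ Set.Icc 0 Real.pi, ‖y₁ x‖ ≤ ‖α‖ + κ * diracNorm g₁ := by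
    intro x hx
    obtain ⟨J, hJ, e⟩ := e1 x hx
    rw [e]
    refine (norm_add_le _ _).trans (add_le_add ?_ hJ)
    rw [norm_mul]
    refine mul_le_of_le_one_left (norm_nonneg _) ?_
    rw [Complex.norm_exp, ← Complex.ofReal_sub, Complex.re_mul_ofReal, hre1, Real.exp_le_one_iff]
    exact mul_nonpos_of_nonneg_of_nonpos him (by linarith [hx.2])
  have b2 : ∀ x ∈ Set.Icc 0 Real.pi, ‖y₂ x‖ ≤ ‖β‖ + κ * diracNorm g₂ := by
    intro x hx
    obtain ⟨J, hJ, e⟩ := e2 x hx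
    rw [e]
    refine (norm_add_le _ _).trans (add_le_add ?_ hJ)
    rw [norm_mul]
    refine mul_le_of_le_one_left (norm_nonneg _) ?_
    rw [Complex.norm_exp, ← Complex.ofReal_sub, Complex.re_mul_ofReal, hre2, Real.exp_le_one_iff]
    nlinarith [hx.1]
  obtain ⟨J₁, hJ₁, e1'⟩ := e1 0 h0
  obtain ⟨J₂, hJ₂, e2'⟩ := e2 Real.pi hπ
  set z := Complex.exp (Complex.I * Real.pi * lam) with hz
  have hz1 : ‖z‖ ≤ 1 := by
    rw [hz, Complex.norm_exp, Real.exp_le_one_iff]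
    have : (Complex.I * Real.pi * lam).re = -(Real.pi * lam.im) := by simp
    rw [this]
    nlinarith [Real.pi_pos]
  rw [show -Complex.I * lam * (((0 : ℝ) : ℂ) - Real.pi) = Complex.I * Real.pi * lam by
    push_cast; ring] at e1'
  rw [show Complex.I * lam * ((Real.pi : ℂ) - ((0 : ℝ) : ℂ)) = Complex.I * Real.pi * lam by
    push_cast; ring] at e2'
  set r : Fin 2 → ℂ := fun i => d i - A i 0 * J₁ - A i 3 * J₂ with hr
  have hrn : ∀ i, ‖r i‖ ≤ ‖d i‖ + S * (κ * diracNorm g₁) + S * (κ * diracNorm g₂) := by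
    intro i
    refine (norm_sub_le _ _).trans (add_le_add ((norm_sub_le _ _).trans (add_le_add le_rfl ?_)) ?_)
    · rw [norm_mul]; exact mul_le_mul (hAS _ _) hJ₁ (norm_nonneg _) hS0
    · rw [norm_mul]; exact mul_le_mul (hAS _ _) hJ₂ (norm_nonneg _) hS0
  set M₁ : Fin 2 → ℂ := fun i => A i 1 + A i 0 * z with hM₁
  set M₂ : Fin 2 → ℂ := fun i => A i 2 + A i 3 * z with hM₂
  have hMn : ∀ i j k, ‖A i j + A i k * z‖ ≤ 2 * S := by
    intro i j k
    refine (norm_add_le _ _).trans ?_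
    rw [norm_mul]
    have := mul_le_mul (hAS i k) hz1 (norm_nonneg _) hS0
    linarith [hAS i j]
  have hsys : ∀ i, α * M₁ i + β * M₂ i = r i := by
    intro i
    have := hbc i
    rw [e1', e2'] at this
    simp only [hM₁, hM₂, hr]
    linear_combination this
  have hdet := norm_charDet_ge hτ hlam
  rw [← hδ, ← hz] at hdet
  set D := bcMinor A 0 3 * z ^ 2 + (bcMinor A 0 2 + bcMinor A 1 3) * z + bcMinor A 1 2 with hD
  have hD' : D = M₁ 0 * M₂ 1 - M₁ 1 * M₂ 0 := by
    simp only [hD, hM₁, hM₂, bcMinor_eq]; ring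
  have hα : α * D = r 0 * M₂ 1 - r 1 * M₂ 0 := by
    rw [hD', ← hsys, ← hsys]; ring
  have hβ : β * D = M₁ 0 * r 1 - M₁ 1 * r 0 := by
    rw [hD', ← hsys, ← hsys]; ring
  set B := decayRate lam.im * (diracNorm g₁ + diracNorm g₂) + (‖d 0‖ + ‖d 1‖) with hB
  have hB1 : κ * diracNorm g₁ ≤ B := by
    have := mul_nonneg hκ0 hn2
    have h1 := norm_nonneg (d 0)
    have h2 := norm_nonneg (d 1)
    rw [hB, mul_add]; linarith
  have hB2 : κ * diracNorm g₂ ≤ B := by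
    have := mul_nonneg hκ0 hn1
    have h1 := norm_nonneg (d 0)
    have h2 := norm_nonneg (d 1)
    rw [hB, mul_add]; linarith
  have hrs : ‖r 0‖ + ‖r 1‖ ≤ (1 + 2 * S) * B := by
    have h1 := hrn 0
    have h2 := hrn 1
    have h3 := mul_nonneg hκ0 hn1
    have h4 := mul_nonneg hκ0 hn2
    have h5 := mul_nonneg hS0 (add_nonneg (norm_nonneg (d 0)) (norm_nonneg (d 1)))
    have h6 : (1 + 2 * S) * B = κ * diracNorm g₁ + κ * diracNorm g₂ + (‖d 0‖ + ‖d 1‖) +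
      2 * (S * (κ * diracNorm g₁)) + 2 * (S * (κ * diracNorm g₂)) +
        2 * (S * (‖d 0‖ + ‖d 1‖)) := by rw [hB]; ring
    rw [h6]
    linarith
  have hγ : ∀ γ : ℂ, ‖γ * D‖ ≤ 2 * S * (‖r 0‖ + ‖r 1‖) → ‖γ‖ ≤ 2 * S / δ * (1 + 2 * S) * B := by
    intro γ h
    rw [norm_mul] at h
    have h1 := mul_le_mul_of_nonneg_left hdet (norm_nonneg γ)
    have h2 := mul_le_mul_of_nonneg_left hrs (mul_nonneg zero_le_two hS0)
    rw [show 2 * S / δ * (1 + 2 * S) * B = 2 * S * ((1 + 2 * S) * B) / δ by ring, le_div_iff₀ hδ0]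
    linarith
  have hαn : ‖α‖ ≤ 2 * S / δ * (1 + 2 * S) * B := by
    apply hγ
    rw [hα]
    refine (norm_sub_le _ _).trans ?_
    rw [norm_mul, norm_mul]
    have h1 := mul_le_mul_of_nonneg_left (hMn 1 2 3) (norm_nonneg (r 0))
    have h2 := mul_le_mul_of_nonneg_left (hMn 0 2 3) (norm_nonneg (r 1))
    linarith
  have hβn : ‖β‖ ≤ 2 * S / δ * (1 + 2 * S) * B := by
    apply hγ
    rw [hβ]
    refine (norm_sub_le _ _).trans ?_
    rw [norm_mul, norm_mul]
    have h1 := mul_le_mul_of_nonneg_right (hMn 0 1 0) (norm_nonneg (r 1))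
    have h2 := mul_le_mul_of_nonneg_right (hMn 1 1 0) (norm_nonneg (r 0))
    linarith
  rw [add_mul, one_mul]
  exact ⟨(b1 x hx).trans (add_le_add hαn hB1), (b2 x hx).trans (add_le_add hβn hB2)⟩

/-- The lower half plane reduces to the upper one: exchanging the components replaces `lam` by
`-lam`. -/
theorem exists_apriori {A : Matrix (Fin 2) (Fin 4) ℂ} (hA : IsRegularBC A)
    {τ₁ τ₂ : ℂ} (hτ : IsCharExponents A τ₁ τ₂) :
    ∃ C : ℝ, 0 ≤ C ∧ ∀ lam ∈ freeRegion τ₁ τ₂, ∀ (g₁ g₂ y₁ y₂ : ℝ → ℂ)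
      (d : Fin 2 → ℂ), MemLp g₁ 2 diracMeasure → MemLp g₂ 2 diracMeasure →
      IsFreeSolution A lam g₁ g₂ d y₁ y₂ → ∀ x ∈ Set.Icc 0 Real.pi,
        ‖y₁ x‖ ≤ C * (decayRate lam.im * (diracNorm g₁ + diracNorm g₂) + (‖d 0‖ + ‖d 1‖)) ∧
        ‖y₂ x‖ ≤ C * (decayRate lam.im * (diracNorm g₁ + diracNorm g₂) + (‖d 0‖ + ‖d 1‖)) := by
  obtain ⟨C, hC, h⟩ := exists_apriori_of_im_nonneg hA hτ
  obtain ⟨C', hC', h'⟩ := exists_apriori_of_im_nonneg hA.swap hτ.swap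
  refine ⟨max C C', le_max_of_le_left hC, ?_⟩
  intro lam hlam g₁ g₂ y₁ y₂ d hg₁ hg₂ hy x hx
  have hB : 0 ≤ decayRate lam.im * (diracNorm g₁ + diracNorm g₂) + (‖d 0‖ + ‖d 1‖) := by
    have h1 := decayRate_nonneg lam.im
    have h2 := diracNorm_nonneg g₁
    have h3 := diracNorm_nonneg g₂
    positivity
  rcases le_total 0 lam.im with him | him
  · have := h lam hlam him g₁ g₂ y₁ y₂ d hg₁ hg₂ hy x hx
    have hm := mul_le_mul_of_nonneg_right (le_max_left C C') hB
    exact ⟨this.1.trans hm, this.2.trans hm⟩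
  · have := h' (-lam) (freeRegion_swap hlam) (by simpa using him) _ _ _ _ d hg₂.neg hg₁.neg
      hy.swap x hx
    have e1 : decayRate (-lam).im = decayRate lam.im := by simp [decayRate]
    rw [e1, diracNorm_neg, diracNorm_neg, add_comm (diracNorm g₂)] at this
    have hm := mul_le_mul_of_nonneg_right (le_max_right C C') hB
    exact ⟨this.2.trans hm, this.1.trans hm⟩

/-! ### Solvability of the free problem -/

lemma isMildSolution_homogeneous (ν c : ℂ) :
    IsMildSolution ν (fun _ => 0) (fun x : ℝ => Complex.exp (ν * x) * c) := by
  intro x _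
  simp

/-- The solution of `y' = ν y + f` with initial value `c`. -/
def mildSolution (ν : ℂ) (f : ℝ → ℂ) (c : ℂ) (x : ℝ) : ℂ :=
  Complex.exp (ν * x) * (c + ∫ s in (0 : ℝ)..x, Complex.exp (-ν * s) * f s)

lemma mildSolution_zero (ν : ℂ) (f : ℝ → ℂ) (c : ℂ) : mildSolution ν f c 0 = c := by
  simp [mildSolution]

lemma isMildSolution_mildSolution (ν : ℂ) (f : ℝ → ℂ) (c : ℂ) :
    IsMildSolution ν f (mildSolution ν f c) := by
  intro x _
  rw [mildSolution_zero, mildSolution]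

/-- Existence follows from uniqueness: the boundary condition is a square linear system for the
initial values, and the a priori bound with zero data makes it injective. -/
theorem exists_isFreeSolution {A : Matrix (Fin 2) (Fin 4) ℂ} (hA : IsRegularBC A)
    {τ₁ τ₂ : ℂ} (hτ : IsCharExponents A τ₁ τ₂) {lam : ℂ} (hl : lam ∈ freeRegion τ₁ τ₂)
    (g₁ g₂ : ℝ → ℂ) : ∃ y₁ y₂ : ℝ → ℂ, IsFreeSolution A lam g₁ g₂ 0 y₁ y₂ := by
  set w := Complex.exp (-Complex.I * lam * Real.pi) with hw
  set z := Complex.exp (Complex.I * lam * Real.pi) with hz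
  let M : Matrix (Fin 2) (Fin 2) ℂ :=
    Matrix.of fun i => ![A i 0 + A i 1 * w, A i 2 + A i 3 * z]
  have hinj : Function.Injective (Matrix.toLin' M) := by
    rw [← LinearMap.ker_eq_bot, LinearMap.ker_eq_bot']
    intro c hc
    obtain ⟨C, _, hC⟩ := exists_apriori hA hτ
    have hsol : IsFreeSolution A lam (fun _ => 0) (fun _ => 0) 0
        (fun x : ℝ => Complex.exp (-Complex.I * lam * x) * c 0)
        (fun x : ℝ => Complex.exp (Complex.I * lam * x) * c 1) := by
      refine ⟨?_, ?_, fun i => ?_⟩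
      · simpa using isMildSolution_homogeneous (-Complex.I * lam) (c 0)
      · simpa using isMildSolution_homogeneous (Complex.I * lam) (c 1)
      · have := congrFun hc i
        simp only [Matrix.toLin'_apply, Matrix.mulVec, dotProduct, Fin.sum_univ_two] at this
        simp [M] at this
        simp only [← hw, ← hz]
        simp
        linear_combination this
    have h := hC lam hl _ _ _ _ _ MemLp.zero' MemLp.zero' hsol 0 ⟨le_rfl, Real.pi_pos.le⟩
    have h0 : diracNorm (fun _ => 0) = 0 := by simp [diracNorm]
    simp [h0] at h
    ext i
    fin_cases i
    · exact h.1
    · exact h.2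
  have hsurj := LinearMap.injective_iff_surjective.1 hinj
  -- The values at `π` of the particular solutions with zero initial values; they form the
  -- right-hand side of the system.
  set p₁ := mildSolution (-Complex.I * lam) (fun x => Complex.I * g₁ x) 0 Real.pi with hp₁
  set p₂ := mildSolution (Complex.I * lam) (fun x => -Complex.I * g₂ x) 0 Real.pi with hp₂
  obtain ⟨c, hc⟩ := hsurj fun i => -(A i 1 * p₁ + A i 3 * p₂)
  refine ⟨mildSolution (-Complex.I * lam) (fun x => Complex.I * g₁ x) (c 0),
    mildSolution (Complex.I * lam) (fun x => -Complex.I * g₂ x) (c 1),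
    isMildSolution_mildSolution _ _ _, isMildSolution_mildSolution _ _ _, fun i => ?_⟩
  have := congrFun hc i
  simp only [Matrix.toLin'_apply, Matrix.mulVec, dotProduct, Fin.sum_univ_two] at this
  simp [M] at this
  have q₁ : mildSolution (-Complex.I * lam) (fun x => Complex.I * g₁ x) (c 0) Real.pi =
      w * c 0 + p₁ := by simp only [hp₁, mildSolution, hw]; ring
  have q₂ : mildSolution (Complex.I * lam) (fun x => -Complex.I * g₂ x) (c 1) Real.pi =
      z * c 1 + p₂ := by simp only [hp₂, mildSolution, hz]; ring
  rw [q₁, q₂, mildSolution_zero, mildSolution_zero]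
  simp only [Pi.zero_apply]
  linear_combination this

/-! ### Continuous pairs, the potential and the embedding into `L²` -/

/-- Pairs of continuous functions on `[0, π]` with the maximum norm. -/
abbrev DiracC : Type := C(Set.Icc 0 Real.pi, ℂ) × C(Set.Icc 0 Real.pi, ℂ)

/-- The constant extension of a function on `[0, π]` to the line. -/
def extendFun (c : C(Set.Icc 0 Real.pi, ℂ)) (x : ℝ) : ℂ :=
  c (Set.projIcc 0 Real.pi Real.pi_pos.le x)

lemma continuous_extendFun (c : C(Set.Icc 0 Real.pi, ℂ)) : Continuous (extendFun c) :=
  c.continuous.comp continuous_projIcc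

lemma extendFun_of_mem (c : C(Set.Icc 0 Real.pi, ℂ)) {x : ℝ} (hx : x ∈ Set.Icc 0 Real.pi) :
    extendFun c x = c ⟨x, hx⟩ := by
  rw [extendFun, Set.projIcc_of_mem _ hx]

lemma norm_extendFun_le (c : C(Set.Icc 0 Real.pi, ℂ)) (x : ℝ) : ‖extendFun c x‖ ≤ ‖c‖ :=
  c.norm_coe_le_norm _

lemma exists_extendFun_eq {y : ℝ → ℂ} (hy : ContinuousOn y (Set.Icc 0 Real.pi)) :
    ∃ c : C(Set.Icc 0 Real.pi, ℂ), ∀ x ∈ Set.Icc 0 Real.pi, extendFun c x = y x :=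
  ⟨⟨(Set.Icc 0 Real.pi).domRestrict y, hy.domRestrict⟩, fun _ hx => extendFun_of_mem _ hx⟩

lemma norm_diracC_le {y : DiracC} {B : ℝ} (hB : 0 ≤ B)
    (h : ∀ x ∈ Set.Icc 0 Real.pi, ‖extendFun y.1 x‖ ≤ B ∧ ‖extendFun y.2 x‖ ≤ B) : ‖y‖ ≤ B := by
  rw [Prod.norm_def]
  refine max_le ?_ ?_ <;> rw [ContinuousMap.norm_le _ hB] <;> intro x
  · have := (h x x.2).1; rwa [extendFun_of_mem _ x.2] at this
  · have := (h x x.2).2; rwa [extendFun_of_mem _ x.2] at this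

lemma memLp_mul_of_bound {p y : ℝ → ℂ} (hp : MemLp p 2 diracMeasure)
    (hy : AEStronglyMeasurable y diracMeasure) {B : ℝ} (hB : ∀ᵐ x ∂diracMeasure, ‖y x‖ ≤ B) :
    MemLp (fun x => p x * y x) 2 diracMeasure := by
  refine MemLp.of_le_mul (c := B) hp (hp.1.mul hy) ?_
  filter_upwards [hB] with x hx
  rw [norm_mul, mul_comm]
  gcongr

lemma diracNorm_mul_le {p y : ℝ → ℂ} (hp : MemLp p 2 diracMeasure) {B : ℝ} (hB0 : 0 ≤ B)
    (hB : ∀ᵐ x ∂diracMeasure, ‖y x‖ ≤ B) :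
    diracNorm (fun x => p x * y x) ≤ B * diracNorm p := by
  have h : ∀ᵐ x ∂diracMeasure, ‖p x * y x‖ ≤ B * ‖p x‖ := by
    filter_upwards [hB] with x hx
    rw [norm_mul, mul_comm]
    gcongr
  have := ENNReal.toReal_mono (ENNReal.mul_ne_top ENNReal.ofReal_ne_top hp.2.ne)
    (eLpNorm_le_mul_eLpNorm_of_ae_le_mul h 2)
  rwa [ENNReal.toReal_mul, ENNReal.toReal_ofReal hB0] at this

lemma diracNorm_add_le {f g : ℝ → ℂ} (hf : MemLp f 2 diracMeasure) (hg : MemLp g 2 diracMeasure) :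
    diracNorm (fun x => f x + g x) ≤ diracNorm f + diracNorm g := by
  have := ENNReal.toReal_mono (ENNReal.add_ne_top.2 ⟨hf.2.ne, hg.2.ne⟩)
    (eLpNorm_add_le hf.1 hg.1 (by norm_num : (1 : ENNReal) ≤ 2))
  rwa [ENNReal.toReal_add hf.2.ne hg.2.ne] at this

lemma memLp_of_continuous {y : ℝ → ℂ} (hy : Continuous y) : MemLp y 2 diracMeasure := by
  obtain ⟨C, hC⟩ := isCompact_Icc.exists_bound_of_continuousOn (s := Set.Icc 0 Real.pi)
    hy.continuousOn
  refine MemLp.of_bound hy.aestronglyMeasurable C ?_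
  rw [ae_diracMeasure_iff]
  exact Eventually.of_forall hC

lemma memLp_pair {g₁ g₂ : ℝ → ℂ} (h₁ : MemLp g₁ 2 diracMeasure) (h₂ : MemLp g₂ 2 diracMeasure) :
    MemLp (fun x => !₂[g₁ x, g₂ x]) 2 diracMeasure := by
  refine MemLp.of_eval_piLp fun i => ?_
  fin_cases i
  · exact h₁
  · exact h₂

lemma memLp_apply (G : DiracL2) (i : Fin 2) : MemLp (fun x => G x i) 2 diracMeasure :=
  (Lp.memLp G).eval_piLp i

lemma diracNorm_apply_le (G : DiracL2) (i : Fin 2) : diracNorm (fun x => G x i) ≤ ‖G‖ := by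
  rw [diracNorm, Lp.norm_def]
  refine ENNReal.toReal_mono (Lp.memLp G).2.ne (eLpNorm_mono fun x => ?_)
  exact PiLp.norm_apply_le (G x) i

lemma diracL2_ext {G H : DiracL2} (h : ∀ᵐ x ∂diracMeasure, G x 0 = H x 0 ∧ G x 1 = H x 1) :
    G = H := by
  apply Lp.ext
  filter_upwards [h] with x hx
  ext i
  fin_cases i
  · exact hx.1
  · exact hx.2

lemma norm_pair_le {g₁ g₂ : ℝ → ℂ} (h₁ : MemLp g₁ 2 diracMeasure) (h₂ : MemLp g₂ 2 diracMeasure) :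
    ‖(memLp_pair h₁ h₂).toLp‖ ≤ diracNorm g₁ + diracNorm g₂ := by
  rw [Lp.norm_toLp, diracNorm, diracNorm, ← ENNReal.toReal_add h₁.2.ne h₂.2.ne]
  refine ENNReal.toReal_mono (ENNReal.add_ne_top.2 ⟨h₁.2.ne, h₂.2.ne⟩) ?_
  have h : ∀ x, ‖!₂[g₁ x, g₂ x]‖ ≤ ‖g₁ x‖ + ‖g₂ x‖ := by
    intro x
    rw [EuclideanSpace.norm_eq, Fin.sum_univ_two]
    refine Real.sqrt_le_iff.2 ⟨by positivity, ?_⟩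
    simp only [Matrix.cons_val_zero, Matrix.cons_val_one]
    nlinarith [norm_nonneg (g₁ x), norm_nonneg (g₂ x)]
  refine (eLpNorm_mono_real h).trans ?_
  refine (eLpNorm_add_le h₁.1.norm h₂.1.norm (by norm_num)).trans (le_of_eq ?_)
  rw [eLpNorm_norm, eLpNorm_norm]

lemma coeFn_pair {g₁ g₂ : ℝ → ℂ} (h : MemLp (fun x => !₂[g₁ x, g₂ x]) 2 diracMeasure) :
    ∀ᵐ x ∂diracMeasure, (h.toLp _ : DiracL2) x 0 = g₁ x ∧ (h.toLp _ : DiracL2) x 1 = g₂ x := by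
  filter_upwards [h.coeFn_toLp] with x hx
  rw [hx]
  simp

lemma coeFn_add_apply (G H : DiracL2) :
    ∀ᵐ x ∂diracMeasure, ∀ i, (G + H : DiracL2) x i = G x i + H x i := by
  filter_upwards [Lp.coeFn_add G H] with x hx i
  rw [hx]; simp

lemma coeFn_sub_apply (G H : DiracL2) :
    ∀ᵐ x ∂diracMeasure, ∀ i, (G - H : DiracL2) x i = G x i - H x i := by
  filter_upwards [Lp.coeFn_sub G H] with x hx i
  rw [hx]; simp

lemma coeFn_smul_apply (c : ℂ) (G : DiracL2) :
    ∀ᵐ x ∂diracMeasure, ∀ i, (c • G : DiracL2) x i = c * G x i := by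
  filter_upwards [Lp.coeFn_smul c G] with x hx i
  rw [hx]; simp

lemma memLp_mul_extendFun {p : ℝ → ℂ} (hp : MemLp p 2 diracMeasure)
    (c : C(Set.Icc 0 Real.pi, ℂ)) : MemLp (fun x => p x * extendFun c x) 2 diracMeasure :=
  memLp_mul_of_bound hp (continuous_extendFun c).aestronglyMeasurable
    (ae_of_all _ (norm_extendFun_le c))

/-- The operator `(y₁, y₂) ↦ (p y₂, q y₁)` from continuous functions to `L²`. -/
def potentialOp {p q : ℝ → ℂ} (hp : MemLp p 2 diracMeasure) (hq : MemLp q 2 diracMeasure) :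
    DiracC →L[ℂ] DiracL2 :=
  LinearMap.mkContinuous
    { toFun := fun y => (memLp_pair (memLp_mul_extendFun hp y.2) (memLp_mul_extendFun hq y.1)).toLp
      map_add' := by
        intro y z
        apply diracL2_ext
        filter_upwards [coeFn_pair (memLp_pair (memLp_mul_extendFun hp (y + z).2)
            (memLp_mul_extendFun hq (y + z).1)),
          coeFn_pair (memLp_pair (memLp_mul_extendFun hp y.2) (memLp_mul_extendFun hq y.1)),
          coeFn_pair (memLp_pair (memLp_mul_extendFun hp z.2) (memLp_mul_extendFun hq z.1)),
          coeFn_add_apply (memLp_pair (memLp_mul_extendFun hp y.2) (memLp_mul_extendFun hq y.1)).toLp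
            (memLp_pair (memLp_mul_extendFun hp z.2) (memLp_mul_extendFun hq z.1)).toLp]
          with x h1 h2 h3 h4
        rw [h4, h4, h1.1, h1.2, h2.1, h2.2, h3.1, h3.2]
        simp only [extendFun, Prod.fst_add, Prod.snd_add, ContinuousMap.add_apply]
        constructor <;> ring
      map_smul' := by
        intro c y
        apply diracL2_ext
        filter_upwards [coeFn_pair (memLp_pair (memLp_mul_extendFun hp (c • y).2)
            (memLp_mul_extendFun hq (c • y).1)),
          coeFn_pair (memLp_pair (memLp_mul_extendFun hp y.2) (memLp_mul_extendFun hq y.1)),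
          coeFn_smul_apply c
            (memLp_pair (memLp_mul_extendFun hp y.2) (memLp_mul_extendFun hq y.1)).toLp]
          with x h1 h2 h4
        rw [RingHom.id_apply, h4, h4, h1.1, h1.2, h2.1, h2.2]
        simp only [extendFun, Prod.smul_fst, Prod.smul_snd, ContinuousMap.smul_apply, smul_eq_mul]
        constructor <;> ring }
    (diracNorm p + diracNorm q) (by
      intro y
      refine (norm_pair_le (memLp_mul_extendFun hp y.2) (memLp_mul_extendFun hq y.1)).trans ?_
      have h1 := diracNorm_mul_le hp (norm_nonneg y)
        (ae_of_all _ fun x => (norm_extendFun_le y.2 x).trans (norm_snd_le y))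
      have h2 := diracNorm_mul_le hq (norm_nonneg y)
        (ae_of_all _ fun x => (norm_extendFun_le y.1 x).trans (norm_fst_le y))
      linarith)

lemma potentialOp_coeFn {p q : ℝ → ℂ} (hp : MemLp p 2 diracMeasure) (hq : MemLp q 2 diracMeasure)
    (y : DiracC) : ∀ᵐ x ∂diracMeasure, potentialOp hp hq y x 0 = p x * extendFun y.2 x ∧
      potentialOp hp hq y x 1 = q x * extendFun y.1 x :=
  coeFn_pair (memLp_pair (memLp_mul_extendFun hp y.2) (memLp_mul_extendFun hq y.1))

lemma norm_potentialOp_le {p q : ℝ → ℂ} (hp : MemLp p 2 diracMeasure)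
    (hq : MemLp q 2 diracMeasure) : ‖potentialOp hp hq‖ ≤ diracNorm p + diracNorm q :=
  LinearMap.mkContinuous_norm_le _ (add_nonneg (diracNorm_nonneg p) (diracNorm_nonneg q)) _

/-- The exchange of the two components. -/
def swapOp : DiracC →L[ℂ] DiracC :=
  (ContinuousLinearMap.snd ℂ _ _).prod (ContinuousLinearMap.fst ℂ _ _)

lemma memLp_one : MemLp (fun _ : ℝ => (1 : ℂ)) 2 diracMeasure := memLp_of_continuous continuous_const

/-- The embedding of the continuous functions into `L²`. -/
def inclusionOp : DiracC →L[ℂ] DiracL2 := (potentialOp memLp_one memLp_one).comp swapOp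

lemma inclusionOp_coeFn (y : DiracC) : ∀ᵐ x ∂diracMeasure,
    inclusionOp y x 0 = extendFun y.1 x ∧ inclusionOp y x 1 = extendFun y.2 x := by
  filter_upwards [potentialOp_coeFn memLp_one memLp_one (swapOp y)] with x hx
  rwa [one_mul, one_mul] at hx

/-- On continuous functions the product is in `L²`, so the default value of `potentialMul` plays no
role for the iterates of the perturbation series. -/
lemma potentialMul_inclusionOp {p q : ℝ → ℂ} (hp : MemLp p 2 diracMeasure)
    (hq : MemLp q 2 diracMeasure) (y : DiracC) :
    potentialMul p q (inclusionOp y) = potentialOp hp hq y := by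
  have hae : (fun x => !₂[p x * inclusionOp y x 1, q x * inclusionOp y x 0]) =ᵐ[diracMeasure]
      fun x => !₂[p x * extendFun y.2 x, q x * extendFun y.1 x] := by
    filter_upwards [inclusionOp_coeFn y] with x hx
    rw [hx.1, hx.2]
  have hm : MemLp (fun x => !₂[p x * inclusionOp y x 1, q x * inclusionOp y x 0]) 2
      diracMeasure :=
    (memLp_congr_ae hae).2 (memLp_pair (memLp_mul_extendFun hp y.2) (memLp_mul_extendFun hq y.1))
  rw [potentialMul, dif_pos hm]
  apply diracL2_ext
  filter_upwards [coeFn_pair hm, inclusionOp_coeFn y, potentialOp_coeFn hp hq y] with x h1 h2 h3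
  rw [h1.1, h1.2, h2.1, h2.2, h3.1, h3.2]
  exact ⟨rfl, rfl⟩

lemma diracSupNorm_inclusionOp_le (y : DiracC) :
    diracSupNorm (inclusionOp y) ≤ ENNReal.ofReal ‖y‖ := by
  have h := inclusionOp_coeFn y
  refine max_le ?_ ?_ <;> rw [eLpNorm_exponent_top] <;> apply eLpNormEssSup_le_of_ae_bound
  · filter_upwards [h] with x hx
    rw [hx.1]
    exact (norm_extendFun_le _ _).trans (norm_fst_le y)
  · filter_upwards [h] with x hx
    rw [hx.2]
    exact (norm_extendFun_le _ _).trans (norm_snd_le y)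

/-! ### Linearity and change of the spectral parameter -/

lemma zero_mem_Icc_pi : (0 : ℝ) ∈ Set.Icc 0 Real.pi := ⟨le_rfl, Real.pi_pos.le⟩

lemma pi_mem_Icc_pi : Real.pi ∈ Set.Icc 0 Real.pi := ⟨Real.pi_pos.le, le_rfl⟩

lemma IsMildSolution.congr {ν : ℂ} {f f' y y' : ℝ → ℂ} (h : IsMildSolution ν f y)
    (hf : ∀ᵐ x ∂diracMeasure, f x = f' x) (hy : ∀ x ∈ Set.Icc 0 Real.pi, y x = y' x) :
    IsMildSolution ν f' y' := by
  intro x hx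
  rw [← hy x hx, ← hy 0 zero_mem_Icc_pi, h x hx]
  congr 2
  apply intervalIntegral.integral_congr_ae
  rw [ae_diracMeasure_iff] at hf
  filter_upwards [hf] with s hs hsx
  rw [hs ((Set.uIcc_subset_Icc zero_mem_Icc_pi hx) (Set.uIoc_subset_uIcc hsx))]

lemma IsMildSolution.add {ν : ℂ} {f f' y y' : ℝ → ℂ} (h : IsMildSolution ν f y)
    (h' : IsMildSolution ν f' y') (hf : IntervalIntegrable f volume 0 Real.pi)
    (hf' : IntervalIntegrable f' volume 0 Real.pi) :
    IsMildSolution ν (fun x => f x + f' x) (fun x => y x + y' x) := by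
  intro x hx
  have e := intervalIntegral.integral_add
    (intervalIntegrable_sub (intervalIntegrable_exp_mul hf (-ν)) zero_mem_Icc_pi hx)
    (intervalIntegrable_sub (intervalIntegrable_exp_mul hf' (-ν)) zero_mem_Icc_pi hx)
  simp only [mul_add]
  rw [e, h x hx, h' x hx]
  ring

lemma IsMildSolution.const_mul {ν : ℂ} {f y : ℝ → ℂ} (h : IsMildSolution ν f y) (c : ℂ) :
    IsMildSolution ν (fun x => c * f x) (fun x => c * y x) := by
  intro x hx
  have e : ∫ s in (0 : ℝ)..x, Complex.exp (-ν * s) * (c * f s) =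
      c * ∫ s in (0 : ℝ)..x, Complex.exp (-ν * s) * f s := by
    rw [← intervalIntegral.integral_const_mul]
    congr 1
    ext s
    ring
  simp only
  rw [e, h x hx]
  ring

/-- Part of the term `ν y` is moved into the inhomogeneity; this is the source of the resolvent
identity. -/
lemma IsMildSolution.change_rate {ν : ℂ} {f y : ℝ → ℂ} (h : IsMildSolution ν f y)
    (hf : IntervalIntegrable f volume 0 Real.pi) (ν' : ℂ) :
    IsMildSolution ν' (fun x => f x + (ν - ν') * y x) y := by
  have hac := h.absolutelyContinuous hf
  have hyi : IntervalIntegrable y volume 0 Real.pi := hac.continuousOn.intervalIntegrable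
  refine isMildSolution_of_absolutelyContinuous (hf.add (hyi.const_mul (ν - ν'))) hac ?_
  filter_upwards [h.ae_hasDerivAt hf] with x hx
  rw [hx.deriv]
  ring

lemma IsFreeSolution.congr {A : Matrix (Fin 2) (Fin 4) ℂ} {lam : ℂ}
    {g₁ g₂ g₁' g₂' y₁ y₂ y₁' y₂' : ℝ → ℂ} {d : Fin 2 → ℂ}
    (h : IsFreeSolution A lam g₁ g₂ d y₁ y₂)
    (hg : ∀ᵐ x ∂diracMeasure, g₁ x = g₁' x ∧ g₂ x = g₂' x)
    (hy : ∀ x ∈ Set.Icc 0 Real.pi, y₁ x = y₁' x ∧ y₂ x = y₂' x) :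
    IsFreeSolution A lam g₁' g₂' d y₁' y₂' := by
  refine ⟨h.1.congr ?_ fun x hx => (hy x hx).1, h.2.1.congr ?_ fun x hx => (hy x hx).2,
    fun i => ?_⟩
  · filter_upwards [hg] with x hx
    rw [hx.1]
  · filter_upwards [hg] with x hx
    rw [hx.2]
  · rw [← (hy 0 zero_mem_Icc_pi).1, ← (hy 0 zero_mem_Icc_pi).2, ← (hy _ pi_mem_Icc_pi).1,
      ← (hy _ pi_mem_Icc_pi).2]
    exact h.2.2 i

lemma IsFreeSolution.add {A : Matrix (Fin 2) (Fin 4) ℂ} {lam : ℂ}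
    {g₁ g₂ g₁' g₂' y₁ y₂ y₁' y₂' : ℝ → ℂ} {d d' : Fin 2 → ℂ}
    (h : IsFreeSolution A lam g₁ g₂ d y₁ y₂) (h' : IsFreeSolution A lam g₁' g₂' d' y₁' y₂')
    (hg₁ : MemLp g₁ 2 diracMeasure) (hg₂ : MemLp g₂ 2 diracMeasure)
    (hg₁' : MemLp g₁' 2 diracMeasure) (hg₂' : MemLp g₂' 2 diracMeasure) :
    IsFreeSolution A lam (fun x => g₁ x + g₁' x) (fun x => g₂ x + g₂' x) (d + d')
      (fun x => y₁ x + y₁' x) (fun x => y₂ x + y₂' x) := by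
  refine ⟨?_, ?_, fun i => ?_⟩
  · have := h.1.add h'.1 (memLp_intervalIntegrable (hg₁.const_mul _))
      (memLp_intervalIntegrable (hg₁'.const_mul _))
    simpa only [← mul_add] using this
  · have := h.2.1.add h'.2.1 (memLp_intervalIntegrable (hg₂.const_mul _))
      (memLp_intervalIntegrable (hg₂'.const_mul _))
    simpa only [← mul_add] using this
  · rw [Pi.add_apply, ← h.2.2 i, ← h'.2.2 i]
    ring

lemma IsFreeSolution.const_mul {A : Matrix (Fin 2) (Fin 4) ℂ} {lam : ℂ}
    {g₁ g₂ y₁ y₂ : ℝ → ℂ} {d : Fin 2 → ℂ}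
    (h : IsFreeSolution A lam g₁ g₂ d y₁ y₂) (c : ℂ) :
    IsFreeSolution A lam (fun x => c * g₁ x) (fun x => c * g₂ x) (c • d)
      (fun x => c * y₁ x) (fun x => c * y₂ x) := by
  refine ⟨?_, ?_, fun i => ?_⟩
  · have := h.1.const_mul c
    simpa only [mul_left_comm c] using this
  · have := h.2.1.const_mul c
    simpa only [mul_left_comm c] using this
  · rw [Pi.smul_apply, ← h.2.2 i, smul_eq_mul]
    ring

lemma IsFreeSolution.change_rate {A : Matrix (Fin 2) (Fin 4) ℂ} {lam : ℂ}
    {g₁ g₂ y₁ y₂ : ℝ → ℂ} {d : Fin 2 → ℂ}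
    (h : IsFreeSolution A lam g₁ g₂ d y₁ y₂) (hg₁ : MemLp g₁ 2 diracMeasure)
    (hg₂ : MemLp g₂ 2 diracMeasure) (mu : ℂ) :
    IsFreeSolution A mu (fun x => g₁ x + (mu - lam) * y₁ x) (fun x => g₂ x + (mu - lam) * y₂ x) d
      y₁ y₂ := by
  refine ⟨?_, ?_, h.2.2⟩
  · have := h.1.change_rate (memLp_intervalIntegrable (hg₁.const_mul _)) (-Complex.I * mu)
    refine this.congr (ae_of_all _ fun x => ?_) fun _ _ => rfl
    ring
  · have := h.2.1.change_rate (memLp_intervalIntegrable (hg₂.const_mul _)) (Complex.I * mu)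
    refine this.congr (ae_of_all _ fun x => ?_) fun _ _ => rfl
    ring

/-! ### The free resolvent from `L²` to continuous functions -/

/-- `y` is a continuous solution of `lam y - L⁰ y = G` that satisfies the boundary condition. -/
def SolvesFree (A : Matrix (Fin 2) (Fin 4) ℂ) (lam : ℂ) (G : DiracL2) (y : DiracC) : Prop :=
  IsFreeSolution A lam (fun x => G x 0) (fun x => G x 1) 0 (extendFun y.1) (extendFun y.2)

/-- The operator `K` maps every `G` to the unique solution of `lam y - L⁰ y = G`. -/
def IsSolutionOperator (A : Matrix (Fin 2) (Fin 4) ℂ) (lam : ℂ) (K : DiracL2 →L[ℂ] DiracC) :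
    Prop :=
  ∀ G y, K G = y ↔ SolvesFree A lam G y

open Classical in
/-- The free resolvent as an operator from `L²` to the continuous functions. -/
def freeOp (A : Matrix (Fin 2) (Fin 4) ℂ) (lam : ℂ) : DiracL2 →L[ℂ] DiracC :=
  if h : ∃ K, IsSolutionOperator A lam K then h.choose else 0

lemma SolvesFree.add {A : Matrix (Fin 2) (Fin 4) ℂ} {lam : ℂ} {G H : DiracL2} {y z : DiracC}
    (hy : SolvesFree A lam G y) (hz : SolvesFree A lam H z) :
    SolvesFree A lam (G + H) (y + z) := by
  have := IsFreeSolution.add hy hz (memLp_apply G 0) (memLp_apply G 1) (memLp_apply H 0)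
    (memLp_apply H 1)
  rw [add_zero] at this
  refine this.congr ?_ fun x _ => ⟨rfl, rfl⟩
  filter_upwards [coeFn_add_apply G H] with x hx
  exact ⟨(hx 0).symm, (hx 1).symm⟩

lemma SolvesFree.const_smul {A : Matrix (Fin 2) (Fin 4) ℂ} {lam : ℂ} {G : DiracL2} {y : DiracC}
    (hy : SolvesFree A lam G y) (c : ℂ) : SolvesFree A lam (c • G) (c • y) := by
  have := IsFreeSolution.const_mul hy c
  rw [smul_zero] at this
  refine this.congr ?_ fun x _ => ⟨rfl, rfl⟩
  filter_upwards [coeFn_smul_apply c G] with x hx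
  exact ⟨(hx 0).symm, (hx 1).symm⟩

lemma SolvesFree.change_rate {A : Matrix (Fin 2) (Fin 4) ℂ} {lam : ℂ} {G : DiracL2} {y : DiracC}
    (hy : SolvesFree A lam G y) (mu : ℂ) :
    SolvesFree A mu (G + (mu - lam) • inclusionOp y) y := by
  have := IsFreeSolution.change_rate hy (memLp_apply G 0) (memLp_apply G 1) mu
  refine this.congr ?_ fun x _ => ⟨rfl, rfl⟩
  filter_upwards [coeFn_add_apply G ((mu - lam) • inclusionOp y),
    coeFn_smul_apply (mu - lam) (inclusionOp y), inclusionOp_coeFn y] with x h1 h2 h3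
  rw [h1, h1, h2, h2, h3.1, h3.2]
  exact ⟨rfl, rfl⟩

/-- The a priori bound with zero boundary data gives uniqueness, and uniqueness makes the solution
map linear; the same bound is its operator norm. -/
theorem exists_solutionOperator_bound {A : Matrix (Fin 2) (Fin 4) ℂ} (hA : IsRegularBC A)
    {τ₁ τ₂ : ℂ} (hτ : IsCharExponents A τ₁ τ₂) :
    ∃ C : ℝ, 0 ≤ C ∧ ∀ lam ∈ freeRegion τ₁ τ₂,
      IsSolutionOperator A lam (freeOp A lam) ∧ ‖freeOp A lam‖ ≤ C * decayRate lam.im := by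
  obtain ⟨C, hC, hb⟩ := exists_apriori hA hτ
  refine ⟨2 * C, by positivity, fun lam hl => ?_⟩
  have hbound : ∀ G y, SolvesFree A lam G y → ‖y‖ ≤ 2 * C * decayRate lam.im * ‖G‖ := by
    intro G y hy
    have hκ := decayRate_nonneg lam.im
    refine norm_diracC_le (by positivity) fun x hx => ?_
    have h := hb lam hl _ _ _ _ _ (memLp_apply G 0) (memLp_apply G 1) hy x hx
    have h0 := diracNorm_apply_le G 0
    have h1 := diracNorm_apply_le G 1
    have h2 : C * (decayRate lam.im * (diracNorm (fun x => G x 0) + diracNorm (fun x => G x 1)) +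
        (‖(0 : Fin 2 → ℂ) 0‖ + ‖(0 : Fin 2 → ℂ) 1‖)) ≤ 2 * C * decayRate lam.im * ‖G‖ := by
      simp only [Pi.zero_apply, norm_zero, add_zero]
      rw [show 2 * C * decayRate lam.im * ‖G‖ = C * (decayRate lam.im * (‖G‖ + ‖G‖)) by ring]
      gcongr
    exact ⟨h.1.trans h2, h.2.trans h2⟩
  have hex : ∀ G, ∃ y, SolvesFree A lam G y := by
    intro G
    obtain ⟨y₁, y₂, hy⟩ := exists_isFreeSolution hA hτ hl (fun x => G x 0) (fun x => G x 1)
    have hc₁ := (hy.1.absolutelyContinuous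
      (memLp_intervalIntegrable ((memLp_apply G 0).const_mul _))).continuousOn
    have hc₂ := (hy.2.1.absolutelyContinuous
      (memLp_intervalIntegrable ((memLp_apply G 1).const_mul _))).continuousOn
    rw [uIcc_zero_pi] at hc₁ hc₂
    obtain ⟨c₁, h₁⟩ := exists_extendFun_eq hc₁
    obtain ⟨c₂, h₂⟩ := exists_extendFun_eq hc₂
    exact ⟨(c₁, c₂), hy.congr (ae_of_all _ fun _ => ⟨rfl, rfl⟩)
      fun x hx => ⟨(h₁ x hx).symm, (h₂ x hx).symm⟩⟩
  have huniq : ∀ G y z, SolvesFree A lam G y → SolvesFree A lam G z → y = z := by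
    intro G y z hy hz
    have h := hbound _ _ (hy.add (hz.const_smul (-1)))
    have e : y + (-1 : ℂ) • z = y - z := by ext <;> simp [sub_eq_add_neg]
    rw [e, neg_smul, one_smul, add_neg_cancel, norm_zero, mul_zero] at h
    exact sub_eq_zero.1 (norm_le_zero_iff.1 h)
  choose k hk using hex
  let K : DiracL2 →L[ℂ] DiracC := LinearMap.mkContinuous
    { toFun := k
      map_add' := fun G H => huniq _ _ _ (hk _) ((hk G).add (hk H))
      map_smul' := fun c G => huniq _ _ _ (hk _) ((hk G).const_smul c) }
    (2 * C * decayRate lam.im) fun G => hbound G _ (hk G)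
  have hK : ∃ K, IsSolutionOperator A lam K :=
    ⟨K, fun G y => ⟨fun h => h ▸ hk G, fun h => huniq _ _ _ (hk G) h⟩⟩
  have hf : IsSolutionOperator A lam (freeOp A lam) := by
    rw [freeOp, dif_pos hK]
    exact hK.choose_spec
  refine ⟨hf, ContinuousLinearMap.opNorm_le_bound _
    (mul_nonneg (by positivity) (decayRate_nonneg _)) fun G => hbound G _ ((hf G _).1 rfl)⟩

lemma IsSolutionOperator.resolvent_identity {A : Matrix (Fin 2) (Fin 4) ℂ} {lam mu : ℂ}
    {K M : DiracL2 →L[ℂ] DiracC} (hK : IsSolutionOperator A lam K)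
    (hM : IsSolutionOperator A mu M) :
    K = M + (mu - lam) • M.comp (inclusionOp.comp K) := by
  ext1 G
  have h := ((hK G _).1 rfl).change_rate mu
  rw [← (hM _ _).2 h]
  simp

/-- The identity gives `K lam (1 - (mu - lam) J K mu) = K mu`. The second factor is affine in `lam`
and equals `1` at `mu`, so it can be inverted nearby, and inversion is differentiable. -/
lemma differentiableOn_of_resolvent_identity {E F : Type*} [NormedAddCommGroup E]
    [NormedSpace ℂ E] [CompleteSpace E] [NormedAddCommGroup F] [NormedSpace ℂ F]
    (J : F →L[ℂ] E) (K : ℂ → E →L[ℂ] F) (s : Set ℂ)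
    (h : ∀ lam ∈ s, ∀ mu ∈ s, K lam = K mu + (mu - lam) • (K mu).comp (J.comp (K lam))) :
    DifferentiableOn ℂ K s := by
  intro mu hmu
  have key : ∀ lam ∈ s, (K lam).comp (1 - (mu - lam) • J.comp (K mu)) = K mu := by
    intro lam hlam
    have h' := h mu hmu lam hlam
    ext1 G
    have := congrArg (fun T : E →L[ℂ] F => T G) h'
    simp at this
    simp [sub_smul] at this ⊢
    refine Eq.trans ?_ this.symm
    abel
  set U : ℂ → E →L[ℂ] E := fun lam => 1 - (mu - lam) • J.comp (K mu) with hU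
  have hUd : Differentiable ℂ U := by
    intro lam
    exact ((((differentiableAt_const mu).sub differentiableAt_id).smul_const _).const_sub 1)
  have hU1 : U mu = 1 := by simp [hU]
  have hinv : DifferentiableAt ℂ (fun lam => Ring.inverse (U lam)) mu :=
    (differentiableAt_inverse (𝕜 := ℂ) (x := U mu) (by rw [hU1]; exact isUnit_one)).comp mu
      (hUd mu)
  have hunit : ∀ᶠ lam in 𝓝 mu, IsUnit (U lam) := by
    have : {T : E →L[ℂ] E | IsUnit T} ∈ 𝓝 (U mu) :=
      Units.isOpen.mem_nhds (by rw [hU1]; exact isUnit_one)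
    exact hUd.continuous.continuousAt this
  have heq : ∀ᶠ lam in 𝓝[s] mu, K lam = (K mu).comp (Ring.inverse (U lam)) := by
    filter_upwards [nhdsWithin_le_nhds hunit, self_mem_nhdsWithin] with lam h1 h2
    rw [← key lam h2, ContinuousLinearMap.comp_assoc]
    change K lam = (K lam).comp (U lam * Ring.inverse (U lam))
    rw [Ring.mul_inverse_cancel _ h1]
    rfl
  have hd : DifferentiableAt ℂ (fun lam => (K mu).comp (Ring.inverse (U lam))) mu :=
    ((ContinuousLinearMap.compL ℂ E E F (K mu)).differentiableAt).comp mu hinv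
  refine hd.differentiableWithinAt.congr_of_eventuallyEq heq ?_
  rw [hU1]
  simp
  rfl

/-! ### Neumann series under a bound on the square -/

section Neumann

variable {E : Type*} [NormedAddCommGroup E] [NormedSpace ℂ E]

lemma isUnit_one_sub_zero : IsUnit (1 - (0 : E →L[ℂ] E)) := by
  rw [sub_zero]; exact isUnit_one

lemma inverse_one_sub_zero : Ring.inverse (1 - (0 : E →L[ℂ] E)) = 1 := by
  rw [sub_zero, Ring.inverse_one]

lemma inverse_one_sub_apply {W : E →L[ℂ] E} (hW : IsUnit (1 - W)) (v : E) :
    Ring.inverse (1 - W) v = v + W (Ring.inverse (1 - W) v) := by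
  have := congrArg (fun T : E →L[ℂ] E => T v) (Ring.mul_inverse_cancel _ hW)
  simp only [mul_apply_eq_comp, sub_apply,
    one_apply_eq_self] at this
  rw [sub_eq_iff_eq_add] at this
  exact this

/-- This identity separates the free term, the linear term and the tail. -/
lemma inverse_one_sub_expansion {W : E →L[ℂ] E} (hW : IsUnit (1 - W)) (v : E) :
    Ring.inverse (1 - W) v = v + (W v + Ring.inverse (1 - W) ((W ^ 2) v)) := by
  have h : Ring.inverse (1 - W) * (1 - W) = 1 := Ring.inverse_mul_cancel _ hW
  have h1 : Ring.inverse (1 - W) = 1 + (W + Ring.inverse (1 - W) * W ^ 2) := by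
    have h2 : Ring.inverse (1 - W) * (1 - W) * (1 + W) = 1 * (1 + W) := by rw [h]
    have h3 : Ring.inverse (1 - W) * (1 - W) * (1 + W) =
        Ring.inverse (1 - W) - Ring.inverse (1 - W) * W ^ 2 := by noncomm_ring
    rw [h3, one_mul, sub_eq_iff_eq_add] at h2
    exact h2.trans (add_assoc _ _ _)
  exact congrArg (fun T : E →L[ℂ] E => T v) h1

variable [CompleteSpace E]

/-- `W` itself need not be small, but `1 - W` is a commuting factor of the unit `1 - W²`. -/
lemma isUnit_one_sub_of_norm_sq_le {W : E →L[ℂ] E} (hW : ‖W * W‖ ≤ 1 / 4) : IsUnit (1 - W) := by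
  have h1 : IsUnit (1 - W * W) := isUnit_one_sub_of_norm_lt_one (by linarith)
  have h2 : (1 - W) * (1 + W) = 1 - W * W := by noncomm_ring
  have hc : Commute (1 - W) (1 + W) := by
    change (1 - W) * (1 + W) = (1 + W) * (1 - W)
    noncomm_ring
  rw [← h2] at h1
  exact (hc.isUnit_mul_iff.1 h1).1

/-- The equation `z = v + W z`, used twice, gives `z = v + W v + W² z`, and the last term can be
absorbed. -/
lemma norm_inverse_one_sub_apply_le {W : E →L[ℂ] E} (hW : ‖W * W‖ ≤ 1 / 4) (v : E) :
    ‖Ring.inverse (1 - W) v‖ ≤ 2 * (1 + ‖W‖) * ‖v‖ := by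
  have h := inverse_one_sub_apply (isUnit_one_sub_of_norm_sq_le hW) v
  set z := Ring.inverse (1 - W) v
  have h' : z = v + W v + (W * W) z := by
    rw [mul_apply_eq_comp]
    have h2 : W z = W v + W (W z) := by
      rw [← map_add]
      exact congrArg W h
    rw [add_assoc, ← h2]
    exact h
  have h1 : ‖z‖ ≤ ‖v‖ + ‖W‖ * ‖v‖ + ‖W * W‖ * ‖z‖ := by
    conv_lhs => rw [h']
    exact (norm_add_le _ _).trans (add_le_add ((norm_add_le _ _).trans
      (add_le_add le_rfl (W.le_opNorm v))) ((W * W).le_opNorm z))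
  have h2 := mul_le_mul_of_nonneg_right hW (norm_nonneg z)
  have h3 := norm_nonneg z
  have h4 := mul_nonneg (norm_nonneg W) (norm_nonneg v)
  have h5 := norm_nonneg v
  nlinarith

/-- Even and odd powers are summed separately, each a geometric series in `W²`. -/
lemma hasSum_pow_apply {W : E →L[ℂ] E} (hW : ‖W * W‖ ≤ 1 / 4) (v : E) :
    HasSum (fun m : ℕ => (W ^ m) v) (Ring.inverse (1 - W) v) := by
  have hs : Summable fun k : ℕ => (W * W) ^ k :=
    summable_geometric_of_norm_lt_one (by linarith)
  have he : Summable fun k : ℕ => W ^ (2 * k) := by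
    refine hs.congr fun k => ?_
    rw [pow_mul, pow_two]
  have ho : Summable fun k : ℕ => W ^ (2 * k + 1) := by
    refine (he.mul_left W).congr fun k => ?_
    rw [pow_succ']
  have hsum : Summable fun m : ℕ => W ^ m := (he.hasSum.even_add_odd ho.hasSum).summable
  have hinv : ∑' m : ℕ, W ^ m = Ring.inverse (1 - W) := by
    have h1 := hsum.tsum_pow_mul_one_sub
    have hu := isUnit_one_sub_of_norm_sq_le hW
    calc ∑' m : ℕ, W ^ m = (∑' m : ℕ, W ^ m) * ((1 - W) * Ring.inverse (1 - W)) := by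
          rw [Ring.mul_inverse_cancel _ hu, mul_one]
      _ = Ring.inverse (1 - W) := by rw [← mul_assoc, h1, one_mul]
  have := hsum.hasSum.mapL (ContinuousLinearMap.apply ℂ E v)
  rw [hinv] at this
  exact this

end Neumann

/-! ### The resolvent of the perturbed operator and its series -/

/-- Moving `V y` to the right turns `lam y - L y = g` into the free equation with right-hand side `g
+ V y`. Elements of the domain have continuous representatives, so nothing is lost by working with
continuous pairs. -/
theorem diracGraph_iff {A : Matrix (Fin 2) (Fin 4) ℂ} {P Q : ℝ → ℂ}
    (hP : MemLp P 2 diracMeasure) (hQ : MemLp Q 2 diracMeasure) {lam : ℂ}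
    {K : DiracL2 →L[ℂ] DiracC} (hK : IsSolutionOperator A lam K) (g u : DiracL2) :
    DiracGraph A P Q u (lam • u - g) ↔
      ∃ y, inclusionOp y = u ∧ K (g + potentialOp hP hQ y) = y := by
  constructor
  · rintro ⟨y₁, y₂, h₁, h₂, -, -, hbc, hu, hf⟩
    have hc₁ := h₁.continuousOn
    have hc₂ := h₂.continuousOn
    rw [uIcc_zero_pi] at hc₁ hc₂
    obtain ⟨c₁, e₁⟩ := exists_extendFun_eq hc₁
    obtain ⟨c₂, e₂⟩ := exists_extendFun_eq hc₂
    have hmem : ∀ᵐ x ∂diracMeasure, x ∈ Set.Icc 0 Real.pi := ae_restrict_mem measurableSet_Icc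
    refine ⟨(c₁, c₂), ?_, (hK _ _).2 ?_⟩
    · apply diracL2_ext
      filter_upwards [hu, inclusionOp_coeFn (c₁, c₂), hmem] with x h1 h2 hx
      rw [h1.1, h1.2, h2.1, h2.2]
      exact ⟨e₁ x hx, e₂ x hx⟩
    · set H := g + potentialOp hP hQ (c₁, c₂) with hH
      have hd : ∀ᵐ x ∂diracMeasure,
          deriv y₁ x = (-Complex.I * lam) * y₁ x + Complex.I * H x 0 ∧
          deriv y₂ x = (Complex.I * lam) * y₂ x + -Complex.I * H x 1 := by
        filter_upwards [hu, hf, coeFn_sub_apply (lam • u) g, coeFn_smul_apply lam u,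
          coeFn_add_apply g (potentialOp hP hQ (c₁, c₂)), potentialOp_coeFn hP hQ (c₁, c₂), hmem]
          with x h1 h2 h3 h4 h5 h6 hx
        obtain ⟨h2a, h2b⟩ := h2
        rw [h3, h4, h1.1] at h2a
        rw [h3, h4, h1.2] at h2b
        rw [hH, h5, h5, h6.1, h6.2]
        rw [e₁ x hx, e₂ x hx]
        constructor
        · linear_combination (Complex.I) * h2a + (deriv y₁ x) * Complex.I_sq
        · linear_combination (-Complex.I) * h2b + (deriv y₂ x) * Complex.I_sq
      have hs : IsFreeSolution A lam (fun x => H x 0) (fun x => H x 1) 0 y₁ y₂ :=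
        ⟨isMildSolution_of_absolutelyContinuous
          (memLp_intervalIntegrable ((memLp_apply H 0).const_mul _)) h₁ (hd.mono fun _ h => h.1),
          isMildSolution_of_absolutelyContinuous
          (memLp_intervalIntegrable ((memLp_apply H 1).const_mul _)) h₂ (hd.mono fun _ h => h.2),
          hbc⟩
      exact hs.congr (ae_of_all _ fun _ => ⟨rfl, rfl⟩)
        fun x hx => ⟨(e₁ x hx).symm, (e₂ x hx).symm⟩
  · rintro ⟨y, rfl, hy⟩
    have hs := (hK _ _).1 hy
    set H := g + potentialOp hP hQ y with hH
    have hm₁ : MemLp (fun x => Complex.I * H x 0) 2 diracMeasure := (memLp_apply H 0).const_mul _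
    have hm₂ : MemLp (fun x => -Complex.I * H x 1) 2 diracMeasure := (memLp_apply H 1).const_mul _
    have hd₁ := hs.1.ae_hasDerivAt (memLp_intervalIntegrable hm₁)
    have hd₂ := hs.2.1.ae_hasDerivAt (memLp_intervalIntegrable hm₂)
    refine ⟨extendFun y.1, extendFun y.2,
      hs.1.absolutelyContinuous (memLp_intervalIntegrable hm₁),
      hs.2.1.absolutelyContinuous (memLp_intervalIntegrable hm₂), ?_, ?_, hs.2.2,
      inclusionOp_coeFn y, ?_⟩
    · refine (memLp_congr_ae (hd₁.mono fun x h => h.deriv)).2 (MemLp.add ?_ hm₁)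
      exact (memLp_of_continuous (continuous_extendFun y.1)).const_mul _
    · refine (memLp_congr_ae (hd₂.mono fun x h => h.deriv)).2 (MemLp.add ?_ hm₂)
      exact (memLp_of_continuous (continuous_extendFun y.2)).const_mul _
    · filter_upwards [hd₁, hd₂, coeFn_sub_apply (lam • inclusionOp y) g,
        coeFn_smul_apply lam (inclusionOp y), coeFn_add_apply g (potentialOp hP hQ y),
        potentialOp_coeFn hP hQ y, inclusionOp_coeFn y] with x h1 h2 h3 h4 h5 h6 h7
      rw [h1.deriv, h2.deriv, hH, h5, h5, h6.1, h6.2, h3, h3, h4, h4, h7.1, h7.2]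
      constructor
      · linear_combination (lam * extendFun y.1 x - g x 0 - P x * extendFun y.2 x) * Complex.I_sq
      · linear_combination (lam * extendFun y.2 x - g x 1 - Q x * extendFun y.1 x) * Complex.I_sq

lemma diracResolvent_eq {A : Matrix (Fin 2) (Fin 4) ℂ} {P Q : ℝ → ℂ} {lam : ℂ}
    {R : DiracL2 →L[ℂ] DiracL2} (hR : IsDiracResolvent A P Q lam R) :
    diracResolvent A P Q lam = R := by
  have hex : ∃ R, IsDiracResolvent A P Q lam R := ⟨R, hR⟩
  rw [diracResolvent, dif_pos hex]
  ext1 g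
  exact (hex.choose_spec g _).2 ((hR g _).1 rfl)

/-- The operator `K V` on continuous functions, where `K` is the free resolvent. -/
def kernelOp (A : Matrix (Fin 2) (Fin 4) ℂ) {P Q : ℝ → ℂ} (hP : MemLp P 2 diracMeasure)
    (hQ : MemLp Q 2 diracMeasure) (lam : ℂ) : DiracC →L[ℂ] DiracC :=
  (freeOp A lam).comp (potentialOp hP hQ)

theorem isDiracResolvent_of_isUnit {A : Matrix (Fin 2) (Fin 4) ℂ} {P Q : ℝ → ℂ}
    (hP : MemLp P 2 diracMeasure) (hQ : MemLp Q 2 diracMeasure) {lam : ℂ}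
    (hK : IsSolutionOperator A lam (freeOp A lam)) (hW : IsUnit (1 - kernelOp A hP hQ lam)) :
    IsDiracResolvent A P Q lam
      (inclusionOp.comp ((Ring.inverse (1 - kernelOp A hP hQ lam)).comp (freeOp A lam))) := by
  set W := kernelOp A hP hQ lam with hWdef
  have h1 : ∀ y, Ring.inverse (1 - W) ((1 - W) y) = y := fun y =>
    congrArg (fun T : DiracC →L[ℂ] DiracC => T y) (Ring.inverse_mul_cancel _ hW)
  have h2 : ∀ y, (1 - W) (Ring.inverse (1 - W) y) = y := fun y =>
    congrArg (fun T : DiracC →L[ℂ] DiracC => T y) (Ring.mul_inverse_cancel _ hW)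
  have hiff : ∀ g y, freeOp A lam (g + potentialOp hP hQ y) = y ↔
      Ring.inverse (1 - W) (freeOp A lam g) = y := by
    intro g y
    have e : freeOp A lam (g + potentialOp hP hQ y) = freeOp A lam g + W y := by
      rw [map_add]; rfl
    rw [e]
    constructor
    · intro h
      rw [← h1 y]
      congr 1
      rw [sub_apply, one_apply_eq_self, eq_sub_iff_add_eq]
      exact h
    · intro h
      have := h2 (freeOp A lam g)
      rw [h, sub_apply, one_apply_eq_self,
        sub_eq_iff_eq_add] at this
      exact this.symm
  intro g u
  rw [diracGraph_iff hP hQ hK]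
  constructor
  · intro h
    exact ⟨_, h, (hiff g _).2 rfl⟩
  · rintro ⟨y, rfl, hy⟩
    rw [← (hiff g y).1 hy]
    rfl

/-- The case `W = 0` of the perturbed resolvent. -/
theorem isDiracResolvent_free {A : Matrix (Fin 2) (Fin 4) ℂ} {lam : ℂ}
    (hK : IsSolutionOperator A lam (freeOp A lam)) :
    IsDiracResolvent A 0 0 lam (inclusionOp.comp (freeOp A lam)) := by
  have h0 : MemLp (0 : ℝ → ℂ) 2 diracMeasure := MemLp.zero
  have hV : potentialOp h0 h0 = 0 := by
    have := norm_potentialOp_le h0 h0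
    rw [show diracNorm 0 = 0 by simp [diracNorm], add_zero] at this
    refine ContinuousLinearMap.ext fun y => ?_
    refine norm_le_zero_iff.1 (((potentialOp h0 h0).le_opNorm y).trans ?_)
    exact mul_nonpos_of_nonpos_of_nonneg this (norm_nonneg y)
  have hW : kernelOp A h0 h0 lam = 0 := by rw [kernelOp, hV, ContinuousLinearMap.comp_zero]
  have := isDiracResolvent_of_isUnit h0 h0 hK (by rw [hW]; exact isUnit_one_sub_zero)
  rw [hW, inverse_one_sub_zero] at this
  exact this

lemma freeResolvent_eq {A : Matrix (Fin 2) (Fin 4) ℂ} {lam : ℂ}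
    (hK : IsSolutionOperator A lam (freeOp A lam)) :
    freeResolvent A lam = inclusionOp.comp (freeOp A lam) :=
  diracResolvent_eq (isDiracResolvent_free hK)

lemma perturbTerm_eq {A : Matrix (Fin 2) (Fin 4) ℂ} {P Q : ℝ → ℂ}
    (hP : MemLp P 2 diracMeasure) (hQ : MemLp Q 2 diracMeasure) {lam : ℂ}
    (hK : IsSolutionOperator A lam (freeOp A lam)) (m : ℕ) (F : DiracL2) :
    perturbTerm A P Q lam m F =
      inclusionOp ((kernelOp A hP hQ lam ^ m) (freeOp A lam F)) := by
  rw [perturbTerm, freeResolvent_eq hK, ContinuousLinearMap.comp_apply]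
  congr 1
  induction m with
  | zero => rfl
  | succ m ih =>
    rw [Function.iterate_succ_apply', pow_succ', mul_apply_eq_comp, ← ih,
      ContinuousLinearMap.comp_apply, potentialMul_inclusionOp hP hQ]
    rfl

lemma hasSum_perturbTerm {A : Matrix (Fin 2) (Fin 4) ℂ} {P Q : ℝ → ℂ}
    (hP : MemLp P 2 diracMeasure) (hQ : MemLp Q 2 diracMeasure) {lam : ℂ}
    (hK : IsSolutionOperator A lam (freeOp A lam))
    (hW : ‖kernelOp A hP hQ lam * kernelOp A hP hQ lam‖ ≤ 1 / 4) (F : DiracL2) :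
    HasSum (fun m : ℕ => perturbTerm A P Q lam (m + 2) F)
      (inclusionOp (Ring.inverse (1 - kernelOp A hP hQ lam)
        ((kernelOp A hP hQ lam ^ 2) (freeOp A lam F)))) := by
  have := (hasSum_pow_apply hW ((kernelOp A hP hQ lam ^ 2) (freeOp A lam F))).mapL inclusionOp
  refine this.congr_fun ?_
  intro m
  rw [perturbTerm_eq hP hQ hK, pow_add, mul_apply_eq_comp]

/-! ### Smallness of the square of the kernel operator -/

lemma decayRate_le (t : ℝ) : decayRate t ≤ √(Real.pi + 1) := by
  apply Real.sqrt_le_sqrt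
  apply div_le_self (by positivity)
  linarith [abs_nonneg t]

/-- Multiplication by `p` moves a solution with rate `ν` into an equation with rate `-ν`. The price
is the large term `2 ν p y` and a remainder that does not involve `ν`. -/
lemma IsMildSolution.mul_smooth {ν : ℂ} {f y p : ℝ → ℂ} (h : IsMildSolution ν f y)
    (hf : IntervalIntegrable f volume 0 Real.pi) (hp : ContDiff ℝ 1 p) :
    IsMildSolution (-ν) (fun x => 2 * ν * (p x * y x) + deriv p x * y x + p x * f x)
      (fun x => p x * y x) := by
  have hac := h.absolutelyContinuous hf
  have hpac : AbsolutelyContinuousOnInterval p 0 Real.pi :=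
    hp.contDiffOn.absolutelyContinuousOnInterval
  have hpd : Continuous (deriv p) := hp.continuous_deriv le_rfl
  have hyc := hac.continuousOn
  have hi1 : IntervalIntegrable (fun x => 2 * ν * (p x * y x)) volume 0 Real.pi :=
    (continuousOn_const.mul (hp.continuous.continuousOn.mul hyc)).intervalIntegrable
  have hi2 : IntervalIntegrable (fun x => deriv p x * y x) volume 0 Real.pi :=
    (hpd.continuousOn.mul hyc).intervalIntegrable
  have hi3 : IntervalIntegrable (fun x => p x * f x) volume 0 Real.pi :=
    hf.continuousOn_mul hp.continuous.continuousOn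
  refine isMildSolution_of_absolutelyContinuous ((hi1.add hi2).add hi3)
    (hpac.mul_complex hac) ?_
  filter_upwards [h.ae_hasDerivAt hf] with x hx
  have hd := ((hp.differentiable one_ne_zero x).hasDerivAt).mul hx
  have : deriv (fun x => p x * y x) x = _ := hd.deriv
  rw [this]
  ring

/-- Let `y = K G` and `z = K M y`, where `M` is the smooth potential. The pair `M y` itself solves
the free equation with right-hand side `2 lam M y + r` and some boundary data `d`. Hence `M y - 2
lam z` solves it with right-hand side `r` and data `d`, both bounded by a multiple of `‖G‖`
independently of `lam`. The a priori bound therefore controls `lam z`; this is why it allows nonzero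
boundary data. -/
lemma exists_commutator_bound {A : Matrix (Fin 2) (Fin 4) ℂ} (hA : IsRegularBC A)
    {τ₁ τ₂ : ℂ} (hτ : IsCharExponents A τ₁ τ₂) {p q : ℝ → ℂ} (hp : ContDiff ℝ 1 p)
    (hq : ContDiff ℝ 1 q) :
    ∃ B : ℝ, 0 ≤ B ∧ ∀ lam ∈ freeRegion τ₁ τ₂, ∀ G : DiracL2,
      ‖lam‖ * ‖freeOp A lam (potentialOp (memLp_of_continuous hp.continuous)
        (memLp_of_continuous hq.continuous) (freeOp A lam G))‖ ≤ B * ‖G‖ := by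
  obtain ⟨C, hC, hap⟩ := exists_apriori hA hτ
  obtain ⟨C', hC', hop⟩ := exists_solutionOperator_bound hA hτ
  set c := √(Real.pi + 1) with hc
  have hpd : Continuous (deriv p) := hp.continuous_deriv le_rfl
  have hqd : Continuous (deriv q) := hq.continuous_deriv le_rfl
  obtain ⟨b₁, hb₁⟩ := isCompact_Icc.exists_bound_of_continuousOn (s := Set.Icc 0 Real.pi)
    hp.continuous.continuousOn
  obtain ⟨b₂, hb₂⟩ := isCompact_Icc.exists_bound_of_continuousOn (s := Set.Icc 0 Real.pi)
    hq.continuous.continuousOn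
  set b := max b₁ b₂ with hb
  have hb0 : 0 ≤ b := le_max_of_le_left ((norm_nonneg _).trans (hb₁ 0 zero_mem_Icc_pi))
  have hpb : ∀ x ∈ Set.Icc 0 Real.pi, ‖p x‖ ≤ b := fun x hx => (hb₁ x hx).trans (le_max_left _ _)
  have hqb : ∀ x ∈ Set.Icc 0 Real.pi, ‖q x‖ ≤ b := fun x hx => (hb₂ x hx).trans (le_max_right _ _)
  set S : ℝ := ∑ i, ∑ j, ‖A i j‖ with hS
  have hS0 : 0 ≤ S := by positivity
  set e := diracNorm (deriv p) + diracNorm (deriv q) with he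
  have he0 : 0 ≤ e := add_nonneg (diracNorm_nonneg _) (diracNorm_nonneg _)
  refine ⟨b * (C' * c) + C * (c * ((C' * c) * e + 2 * b) + S * (b * (C' * c))), by positivity, ?_⟩
  intro lam hl G
  obtain ⟨hK, hKn⟩ := hop lam hl
  set y := freeOp A lam G with hy
  have hyn : ‖y‖ ≤ C' * c * ‖G‖ := by
    refine ((freeOp A lam).le_opNorm G).trans ?_
    have : ‖freeOp A lam‖ ≤ C' * c :=
      hKn.trans (mul_le_mul_of_nonneg_left (decayRate_le _) hC')
    gcongr
  have hys : SolvesFree A lam G y := (hK _ _).1 rfl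
  set M := potentialOp (memLp_of_continuous hp.continuous) (memLp_of_continuous hq.continuous)
    with hM
  set z := freeOp A lam (M y) with hz
  have hzs : SolvesFree A lam (M y) z := (hK _ _).1 rfl
  set u₁ := extendFun y.1 with hu₁
  set u₂ := extendFun y.2 with hu₂
  have hu₁c : Continuous u₁ := continuous_extendFun y.1
  have hu₂c : Continuous u₂ := continuous_extendFun y.2
  have hu₁n : ∀ x, ‖u₁ x‖ ≤ ‖y‖ := fun x => (norm_extendFun_le _ _).trans (norm_fst_le y)
  have hu₂n : ∀ x, ‖u₂ x‖ ≤ ‖y‖ := fun x => (norm_extendFun_le _ _).trans (norm_snd_le y)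
  have hg₁ := memLp_apply G 0
  have hg₂ := memLp_apply G 1
  have hzs' : IsFreeSolution A lam (fun x => p x * u₂ x) (fun x => q x * u₁ x) 0
      (extendFun z.1) (extendFun z.2) :=
    hzs.congr (potentialOp_coeFn _ _ y) fun _ _ => ⟨rfl, rfl⟩
  have h1 := hys.2.1.mul_smooth (memLp_intervalIntegrable (hg₂.const_mul _)) hp
  have h2 := hys.1.mul_smooth (memLp_intervalIntegrable (hg₁.const_mul _)) hq
  set r₁ : ℝ → ℂ := fun x => -Complex.I * (deriv p x * u₂ x) + -1 * (G x 1 * p x) with hr₁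
  set r₂ : ℝ → ℂ := fun x => Complex.I * (deriv q x * u₁ x) + -1 * (G x 0 * q x) with hr₂
  set d : Fin 2 → ℂ := fun i => A i 0 * (p 0 * u₂ 0) + A i 1 * (p Real.pi * u₂ Real.pi) +
    A i 2 * (q 0 * u₁ 0) + A i 3 * (q Real.pi * u₁ Real.pi) with hd
  have hh : IsFreeSolution A lam (fun x => 2 * lam * (p x * u₂ x) + r₁ x)
      (fun x => 2 * lam * (q x * u₁ x) + r₂ x) d (fun x => p x * u₂ x) (fun x => q x * u₁ x) := by
    refine ⟨?_, ?_, fun i => rfl⟩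
    · rw [neg_mul]
      refine h1.congr (ae_of_all _ fun x => ?_) fun _ _ => rfl
      simp only [hr₁]
      linear_combination (deriv p x * u₂ x) * Complex.I_sq
    · rw [show Complex.I * lam = -(-Complex.I * lam) by ring]
      refine h2.congr (ae_of_all _ fun x => ?_) fun _ _ => rfl
      simp only [hr₂]
      linear_combination (deriv q x * u₁ x) * Complex.I_sq
  have hpm : MemLp (deriv p) 2 diracMeasure := memLp_of_continuous hpd
  have hqm : MemLp (deriv q) 2 diracMeasure := memLp_of_continuous hqd
  have hpu : MemLp (fun x => p x * u₂ x) 2 diracMeasure :=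
    memLp_of_continuous (hp.continuous.mul hu₂c)
  have hqu : MemLp (fun x => q x * u₁ x) 2 diracMeasure :=
    memLp_of_continuous (hq.continuous.mul hu₁c)
  have hpbae : ∀ᵐ x ∂diracMeasure, ‖p x‖ ≤ b := ae_diracMeasure_iff.2 (Eventually.of_forall hpb)
  have hqbae : ∀ᵐ x ∂diracMeasure, ‖q x‖ ≤ b := ae_diracMeasure_iff.2 (Eventually.of_forall hqb)
  have m1 : MemLp (fun x => deriv p x * u₂ x) 2 diracMeasure :=
    memLp_of_continuous (hpd.mul hu₂c)
  have m2 : MemLp (fun x => deriv q x * u₁ x) 2 diracMeasure :=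
    memLp_of_continuous (hqd.mul hu₁c)
  have m3 : MemLp (fun x => G x 1 * p x) 2 diracMeasure :=
    memLp_mul_of_bound hg₂ hp.continuous.aestronglyMeasurable hpbae
  have m4 : MemLp (fun x => G x 0 * q x) 2 diracMeasure :=
    memLp_mul_of_bound hg₁ hq.continuous.aestronglyMeasurable hqbae
  have hr₁m : MemLp r₁ 2 diracMeasure := (m1.const_mul _).add (m3.const_mul _)
  have hr₂m : MemLp r₂ 2 diracMeasure := (m2.const_mul _).add (m4.const_mul _)
  have hr₁n : diracNorm r₁ ≤ ‖y‖ * diracNorm (deriv p) + b * ‖G‖ := by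
    refine (diracNorm_add_le (m1.const_mul _) (m3.const_mul _)).trans ?_
    rw [diracNorm_const_mul, diracNorm_const_mul]
    have e1 := diracNorm_mul_le hpm (norm_nonneg y) (ae_of_all _ hu₂n)
    have e2 := diracNorm_mul_le hg₂ hb0 hpbae
    have e3 := mul_le_mul_of_nonneg_left (diracNorm_apply_le G 1) hb0
    simp only [norm_neg, Complex.norm_I, norm_one, one_mul]
    linarith
  have hr₂n : diracNorm r₂ ≤ ‖y‖ * diracNorm (deriv q) + b * ‖G‖ := by
    refine (diracNorm_add_le (m2.const_mul _) (m4.const_mul _)).trans ?_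
    rw [diracNorm_const_mul, diracNorm_const_mul]
    have e1 := diracNorm_mul_le hqm (norm_nonneg y) (ae_of_all _ hu₁n)
    have e2 := diracNorm_mul_le hg₁ hb0 hqbae
    have e3 := mul_le_mul_of_nonneg_left (diracNorm_apply_le G 0) hb0
    simp only [norm_neg, Complex.norm_I, norm_one, one_mul]
    linarith
  have hpun : ∀ x ∈ Set.Icc 0 Real.pi, ‖p x * u₂ x‖ ≤ b * ‖y‖ := fun x hx => by
    rw [norm_mul]; exact mul_le_mul (hpb x hx) (hu₂n x) (norm_nonneg _) hb0
  have hqun : ∀ x ∈ Set.Icc 0 Real.pi, ‖q x * u₁ x‖ ≤ b * ‖y‖ := fun x hx => by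
    rw [norm_mul]; exact mul_le_mul (hqb x hx) (hu₁n x) (norm_nonneg _) hb0
  have hdn : ‖d 0‖ + ‖d 1‖ ≤ S * (b * ‖y‖) := by
    have hdi : ∀ i, ‖d i‖ ≤ (∑ j, ‖A i j‖) * (b * ‖y‖) := by
      intro i
      rw [Fin.sum_univ_four, add_mul, add_mul, add_mul]
      refine (norm_add_le _ _).trans (add_le_add ((norm_add_le _ _).trans (add_le_add
        ((norm_add_le _ _).trans (add_le_add ?_ ?_)) ?_)) ?_) <;> rw [norm_mul] <;>
        refine mul_le_mul_of_nonneg_left ?_ (norm_nonneg _)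
      · exact hpun _ zero_mem_Icc_pi
      · exact hpun _ pi_mem_Icc_pi
      · exact hqun _ zero_mem_Icc_pi
      · exact hqun _ pi_mem_Icc_pi
    rw [hS, Fin.sum_univ_two, add_mul]
    exact add_le_add (hdi 0) (hdi 1)
  -- The large terms `2 lam M y` cancel.
  have hdiff : IsFreeSolution A lam r₁ r₂ d
      (fun x => p x * u₂ x + -(2 * lam) * extendFun z.1 x)
      (fun x => q x * u₁ x + -(2 * lam) * extendFun z.2 x) := by
    have := hh.add (hzs'.const_mul (-(2 * lam))) ((hpu.const_mul _).add hr₁m)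
      ((hqu.const_mul _).add hr₂m) (hpu.const_mul _) (hqu.const_mul _)
    rw [smul_zero, add_zero] at this
    refine this.congr (ae_of_all _ fun x => ⟨?_, ?_⟩) fun _ _ => ⟨rfl, rfl⟩ <;> ring
  set E := C * (c * (‖y‖ * e + 2 * b * ‖G‖) + S * (b * ‖y‖)) with hE
  have hEb : C * (decayRate lam.im * (diracNorm r₁ + diracNorm r₂) + (‖d 0‖ + ‖d 1‖)) ≤ E := by
    have k1 : diracNorm r₁ + diracNorm r₂ ≤ ‖y‖ * e + 2 * b * ‖G‖ := by
      rw [he, mul_add]; linarith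
    have k2 := mul_le_mul (decayRate_le lam.im) k1
      (add_nonneg (diracNorm_nonneg _) (diracNorm_nonneg _)) (Real.sqrt_nonneg _)
    exact mul_le_mul_of_nonneg_left (add_le_add k2 hdn) hC
  have hzn : ‖(2 * lam) • z‖ ≤ b * ‖y‖ + E := by
    refine norm_diracC_le (by positivity) fun x hx => ?_
    have k := hap lam hl r₁ r₂ _ _ d hr₁m hr₂m hdiff x hx
    constructor
    · have k1 : extendFun ((2 * lam) • z).1 x = p x * u₂ x -
          (p x * u₂ x + -(2 * lam) * extendFun z.1 x) := by
        change 2 * lam * extendFun z.1 x = _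
        ring
      rw [k1]
      exact (norm_sub_le _ _).trans (add_le_add (hpun x hx) (k.1.trans hEb))
    · have k1 : extendFun ((2 * lam) • z).2 x = q x * u₁ x -
          (q x * u₁ x + -(2 * lam) * extendFun z.2 x) := by
        change 2 * lam * extendFun z.2 x = _
        ring
      rw [k1]
      exact (norm_sub_le _ _).trans (add_le_add (hqun x hx) (k.2.trans hEb))
  rw [norm_smul, norm_mul, Complex.norm_ofNat] at hzn
  have hlz : 0 ≤ ‖lam‖ * ‖z‖ := by positivity
  have hfin : b * ‖y‖ + E ≤ (b * (C' * c) + C * (c * ((C' * c) * e + 2 * b) +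
      S * (b * (C' * c)))) * ‖G‖ := by
    have : (b * (C' * c) + C * (c * ((C' * c) * e + 2 * b) + S * (b * (C' * c)))) * ‖G‖ =
        b * (C' * c * ‖G‖) + C * (c * ((C' * c * ‖G‖) * e + 2 * b * ‖G‖) +
          S * (b * (C' * c * ‖G‖))) := by ring
    rw [this, hE]
    gcongr
  linarith

lemma exists_smooth_diracNorm_sub_le {P : ℝ → ℂ} (hP : MemLp P 2 diracMeasure) {η : ℝ}
    (hη : 0 < η) : ∃ p : ℝ → ℂ, ContDiff ℝ 1 p ∧ diracNorm (P - p) ≤ η := by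
  obtain ⟨p, -, hp, hn⟩ := hP.exist_eLpNorm_sub_le (by norm_num) (by norm_num) hη
  refine ⟨p, hp.of_le (by exact_mod_cast le_top), ?_⟩
  exact ENNReal.toReal_le_of_le_ofReal hη.le hn

/-- Only the left factor `V` in `K V K V` is split into a smooth part, where the gain `1 / lam`
applies, and a part of small `L²` norm, where the uniform bound on `K` suffices. -/
theorem kernelOp_sq_small {A : Matrix (Fin 2) (Fin 4) ℂ} (hA : IsRegularBC A)
    {τ₁ τ₂ : ℂ} (hτ : IsCharExponents A τ₁ τ₂) {P Q : ℝ → ℂ}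
    (hP : MemLp P 2 diracMeasure) (hQ : MemLp Q 2 diracMeasure) {ε : ℝ} (hε : 0 < ε) :
    ∃ ρ : ℝ, ∀ lam ∈ freeRegion τ₁ τ₂, ρ ≤ ‖lam‖ →
      ‖kernelOp A hP hQ lam * kernelOp A hP hQ lam‖ ≤ ε := by
  obtain ⟨C', hC', hop⟩ := exists_solutionOperator_bound hA hτ
  set c := C' * √(Real.pi + 1) with hc
  have hc0 : 0 ≤ c := by positivity
  set m := diracNorm P + diracNorm Q with hm
  have hm0 : 0 ≤ m := add_nonneg (diracNorm_nonneg _) (diracNorm_nonneg _)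
  -- Makes the rough part contribute at most `ε / 2`; the `+ 1` avoids division by zero.
  set η := ε / (4 * (c * c * m + 1)) with hη
  have hη0 : 0 < η := by positivity
  obtain ⟨p, hp, hpn⟩ := exists_smooth_diracNorm_sub_le hP hη0
  obtain ⟨q, hq, hqn⟩ := exists_smooth_diracNorm_sub_le hQ hη0
  obtain ⟨B, hB, hcomm⟩ := exists_commutator_bound hA hτ hp hq
  -- From here on `B m / ‖lam‖ ≤ ε / 2`; the `+ 1` keeps `lam` away from zero.
  refine ⟨2 * B * m / ε + 1, fun lam hl hρ => ?_⟩
  obtain ⟨hK, hKn⟩ := hop lam hl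
  have hKc : ‖freeOp A lam‖ ≤ c := hKn.trans (mul_le_mul_of_nonneg_left (decayRate_le _) hC')
  have hpm := memLp_of_continuous hp.continuous
  have hqm := memLp_of_continuous hq.continuous
  have hPp : MemLp (P - p) 2 diracMeasure := hP.sub hpm
  have hQq : MemLp (Q - q) 2 diracMeasure := hQ.sub hqm
  have hsplit : ∀ y, potentialOp hP hQ y = potentialOp hpm hqm y + potentialOp hPp hQq y := by
    intro y
    apply diracL2_ext
    filter_upwards [potentialOp_coeFn hP hQ y, potentialOp_coeFn hpm hqm y,
      potentialOp_coeFn hPp hQq y,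
      coeFn_add_apply (potentialOp hpm hqm y) (potentialOp hPp hQq y)] with x h1 h2 h3 h4
    rw [h4, h4, h1.1, h1.2, h2.1, h2.2, h3.1, h3.2]
    simp only [Pi.sub_apply]
    constructor <;> ring
  have hl0 : 0 < ‖lam‖ := lt_of_lt_of_le (by positivity) hρ
  refine ContinuousLinearMap.opNorm_le_bound _ hε.le fun y => ?_
  set G := potentialOp hP hQ y with hG
  have hGn : ‖G‖ ≤ m * ‖y‖ := ((potentialOp hP hQ).le_opNorm y).trans
    (mul_le_mul_of_nonneg_right (norm_potentialOp_le hP hQ) (norm_nonneg y))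
  have e : (kernelOp A hP hQ lam * kernelOp A hP hQ lam) y =
      freeOp A lam (potentialOp hpm hqm (freeOp A lam G)) +
        freeOp A lam (potentialOp hPp hQq (freeOp A lam G)) := by
    rw [← map_add, ← hsplit]
    rfl
  rw [e]
  have e1 : ‖freeOp A lam (potentialOp hpm hqm (freeOp A lam G))‖ ≤ ε / 2 * ‖y‖ := by
    have h1 := hcomm lam hl G
    have h2 : 2 * B * m / ε ≤ ‖lam‖ := by linarith
    rw [div_le_iff₀ hε] at h2
    have h3 : ‖lam‖ * ‖freeOp A lam (potentialOp hpm hqm (freeOp A lam G))‖ ≤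
        ‖lam‖ * (ε / 2 * ‖y‖) := by
      refine h1.trans ?_
      have h4 := mul_le_mul_of_nonneg_left hGn hB
      have h5 := mul_le_mul_of_nonneg_right h2 (norm_nonneg y)
      linarith
    exact le_of_mul_le_mul_left h3 hl0
  have e2 : ‖freeOp A lam (potentialOp hPp hQq (freeOp A lam G))‖ ≤ ε / 2 * ‖y‖ := by
    have h1 : ‖potentialOp hPp hQq‖ ≤ 2 * η := (norm_potentialOp_le hPp hQq).trans (by linarith)
    calc ‖freeOp A lam (potentialOp hPp hQq (freeOp A lam G))‖
        ≤ c * (2 * η * (c * (m * ‖y‖))) :=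
          (freeOp A lam).le_of_opNorm_le_of_le hKc
            ((potentialOp hPp hQq).le_of_opNorm_le_of_le h1
              ((freeOp A lam).le_of_opNorm_le_of_le hKc hGn))
      _ = 2 * (c * c * m) * η * ‖y‖ := by ring
      _ ≤ ε / 2 * ‖y‖ := by
          refine mul_le_mul_of_nonneg_right ?_ (norm_nonneg y)
          rw [hη, ← mul_div_assoc, div_le_iff₀ (by positivity)]
          nlinarith [mul_nonneg (mul_nonneg hc0 hc0) hm0]
  calc _ ≤ ε / 2 * ‖y‖ + ε / 2 * ‖y‖ := (norm_add_le _ _).trans (add_le_add e1 e2)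
    _ = ε * ‖y‖ := by ring

/-! ### The contours avoid the free spectrum -/

lemma half_le_norm_exp_sub_one {w : ℂ} (hw : 1 ≤ |w.re|) : 1 / 2 ≤ ‖Complex.exp w - 1‖ := by
  have hn : ‖Complex.exp w‖ = Real.exp w.re := Complex.norm_exp w
  rcases le_abs.1 hw with h | h
  · have h1 : 2 ≤ Real.exp w.re := by linarith [Real.add_one_le_exp w.re]
    have h2 := norm_sub_norm_le (Complex.exp w) 1
    rw [hn, norm_one] at h2
    linarith
  · have h1 : 2 ≤ Real.exp (-w.re) := by linarith [Real.add_one_le_exp (-w.re)]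
    have h3 : Real.exp w.re * Real.exp (-w.re) = 1 := by rw [← Real.exp_add]; simp
    have h2 := norm_sub_norm_le 1 (Complex.exp w)
    rw [hn, norm_one, norm_sub_rev] at h2
    nlinarith [Real.exp_pos w.re]

/-- The real part of `exp w - 1` is at most `-1`. -/
lemma half_le_norm_exp_sub_one_of_cos {w : ℂ} (hw : Real.cos w.im ≤ 0) :
    1 / 2 ≤ ‖Complex.exp w - 1‖ := by
  have h1 := Complex.abs_re_le_norm (Complex.exp w - 1)
  rw [Complex.sub_re, Complex.exp_re, Complex.one_re] at h1
  have h2 := neg_abs_le (Real.exp w.re * Real.cos w.im - 1)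
  have h3 := mul_nonpos_of_nonneg_of_nonpos (Real.exp_pos w.re).le hw
  linarith

lemma mem_freeRegion_of_im {τ₁ τ₂ lam : ℂ} (h₁ : |τ₁.im| + 1 ≤ |lam.im|)
    (h₂ : |τ₂.im| + 1 ≤ |lam.im|) : lam ∈ freeRegion τ₁ τ₂ := by
  intro τ hτ
  have h : |τ.im| + 1 ≤ |lam.im| := by rcases hτ with rfl | rfl <;> assumption
  have h3 : 1 ≤ |lam.im - τ.im| := by
    have := abs_sub_abs_le_abs_sub lam.im τ.im
    linarith
  have hπ : 1 ≤ Real.pi := by linarith [Real.pi_gt_three]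
  have key : 1 ≤ Real.pi * |lam.im - τ.im| := by nlinarith
  constructor <;> apply half_le_norm_exp_sub_one
  · have : (Complex.I * Real.pi * (lam - τ)).re = -(Real.pi * (lam.im - τ.im)) := by simp
    rw [this, abs_neg, abs_mul, abs_of_pos Real.pi_pos]
    exact key
  · have : (Complex.I * Real.pi * (τ - lam)).re = Real.pi * (lam.im - τ.im) := by simp; ring
    rw [this, abs_mul, abs_of_pos Real.pi_pos]
    exact key

/-- As `N` is even, `θ` differs from `φ` by an odd integer, so the cosine changes sign; it is
nonnegative at `πφ`. -/
lemma cos_nonpos_of_odd_shift {N : ℕ} (hN : Even N) {θ φ : ℝ} (hφ : |φ| ≤ 1 / 2)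
    (hθ : |θ - φ| = N + 1) : Real.cos (Real.pi * θ) ≤ 0 := by
  obtain ⟨k, rfl⟩ := hN
  have hc : 0 ≤ Real.cos (Real.pi * φ) := by
    rw [abs_le] at hφ
    apply Real.cos_nonneg_of_neg_pi_div_two_le_of_le <;> nlinarith [Real.pi_pos]
  have key : ∀ m : ℤ, Real.cos (Real.pi * φ + (2 * m + 1 : ℤ) * Real.pi) =
      -Real.cos (Real.pi * φ) := by
    intro m
    rw [show Real.pi * φ + (2 * m + 1 : ℤ) * Real.pi =
      Real.pi * φ + Real.pi + m * (2 * Real.pi) by push_cast; ring,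
      Real.cos_add_int_mul_two_pi, Real.cos_add_pi]
  push_cast at hθ
  rcases eq_or_eq_neg_of_abs_eq hθ with h | h
  · have := key k
    rw [show Real.pi * φ + (2 * (k : ℤ) + 1 : ℤ) * Real.pi = Real.pi * θ by
      push_cast; linear_combination (-Real.pi) * h] at this
    linarith
  · have := key (-k - 1)
    rw [show Real.pi * φ + (2 * (-(k : ℤ) - 1) + 1 : ℤ) * Real.pi = Real.pi * θ by
      push_cast; linear_combination (-Real.pi) * h] at this
    linarith

/-- The condition `|Re τ₁ - Re τ₂| ≤ 1` puts the centre within `1 / 2` of both real parts, so one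
vertical line serves both exponents. -/
lemma mem_freeRegion_of_re {τ₁ τ₂ lam : ℂ} (hτ : |τ₁.re - τ₂.re| ≤ 1) {N : ℕ} (hN : Even N)
    (hl : |lam.re - contourCentre τ₁ τ₂| = N + 1) : lam ∈ freeRegion τ₁ τ₂ := by
  intro τ h
  have hc : contourCentre τ₁ τ₂ = (τ₁.re + τ₂.re) / 2 := by
    simp [contourCentre]
  have h1 : |contourCentre τ₁ τ₂ - τ.re| ≤ 1 / 2 := by
    rw [hc]
    rw [abs_le] at hτ ⊢
    rcases h with rfl | rfl <;> constructor <;> linarith [hτ.1, hτ.2]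
  have h2 : Real.cos (Real.pi * (lam.re - τ.re)) ≤ 0 :=
    cos_nonpos_of_odd_shift hN h1 (by rw [sub_sub_sub_cancel_right]; exact hl)
  constructor <;> apply half_le_norm_exp_sub_one_of_cos
  · have : (Complex.I * Real.pi * (lam - τ)).im = Real.pi * (lam.re - τ.re) := by simp
    rwa [this]
  · have : (Complex.I * Real.pi * (τ - lam)).im = -(Real.pi * (lam.re - τ.re)) := by simp; ring
    rwa [this, Real.cos_neg]

/-! ### Integrals over boundaries of rectangles -/

section Rectangle

variable {E F : Type*} [NormedAddCommGroup E] [NormedSpace ℂ E]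
  [NormedAddCommGroup F] [NormedSpace ℂ F]

/-- `(1 / 2πi) ∫ f(z) dz` over the boundary of the rectangle `(a, b) × (-T, T)`. -/
def rectIntegral (a b T : ℝ) (f : ℂ → E) : E :=
  (2 * Real.pi * Complex.I : ℂ)⁻¹ •
    ((∫ x : ℝ in a..b, f (x + (-T : ℝ) * Complex.I)) -
      (∫ x : ℝ in a..b, f (x + (T : ℝ) * Complex.I)) +
      Complex.I • (∫ t : ℝ in (-T)..T, f (b + t * Complex.I)) -
      Complex.I • (∫ t : ℝ in (-T)..T, f (a + t * Complex.I)))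

/-- The boundary of the rectangle `(a, b) × (-T, T)`. -/
def rectBoundary (a b T : ℝ) : Set ℂ :=
  {z | (z.re ∈ Set.Icc a b ∧ |z.im| = T) ∨ ((z.re = a ∨ z.re = b) ∧ |z.im| ≤ T)}

lemma contourIntegral_eq_rectIntegral (τ₁ τ₂ : ℂ) (N : ℕ) (T : ℝ) (f : ℂ → DiracL2) :
    contourIntegral τ₁ τ₂ N T f =
      rectIntegral (contourCentre τ₁ τ₂ - (N + 1)) (contourCentre τ₁ τ₂ + (N + 1)) T f := rfl

variable {a b T : ℝ}

lemma lower_mem_rectBoundary (hT : 0 ≤ T) {x : ℝ} (hx : x ∈ Set.Icc a b) :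
    (x + (-T : ℝ) * Complex.I : ℂ) ∈ rectBoundary a b T := by
  left; simpa [abs_of_nonneg hT] using hx

lemma upper_mem_rectBoundary (hT : 0 ≤ T) {x : ℝ} (hx : x ∈ Set.Icc a b) :
    (x + (T : ℝ) * Complex.I : ℂ) ∈ rectBoundary a b T := by
  left; simpa [abs_of_nonneg hT] using hx

lemma right_mem_rectBoundary {t : ℝ} (ht : t ∈ Set.Icc (-T) T) :
    (b + t * Complex.I : ℂ) ∈ rectBoundary a b T := by
  right; simpa using abs_le.2 ht

lemma left_mem_rectBoundary {t : ℝ} (ht : t ∈ Set.Icc (-T) T) :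
    (a + t * Complex.I : ℂ) ∈ rectBoundary a b T := by
  right; simpa using abs_le.2 ht

lemma rectIntegral_congr (hab : a ≤ b) (hT : 0 ≤ T) {f g : ℂ → E}
    (h : ∀ z ∈ rectBoundary a b T, f z = g z) : rectIntegral a b T f = rectIntegral a b T g := by
  have hTT : -T ≤ T := by linarith
  have e1 : ∫ x : ℝ in a..b, f (x + (-T : ℝ) * Complex.I) =
      ∫ x : ℝ in a..b, g (x + (-T : ℝ) * Complex.I) := intervalIntegral.integral_congr fun x hx =>
    h _ (lower_mem_rectBoundary hT (Set.uIcc_of_le hab ▸ hx))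
  have e2 : ∫ x : ℝ in a..b, f (x + (T : ℝ) * Complex.I) =
      ∫ x : ℝ in a..b, g (x + (T : ℝ) * Complex.I) := intervalIntegral.integral_congr fun x hx =>
    h _ (upper_mem_rectBoundary hT (Set.uIcc_of_le hab ▸ hx))
  have e3 : ∫ t : ℝ in (-T)..T, f (b + t * Complex.I) =
      ∫ t : ℝ in (-T)..T, g (b + t * Complex.I) := intervalIntegral.integral_congr fun x hx =>
    h _ (right_mem_rectBoundary (Set.uIcc_of_le hTT ▸ hx))
  have e4 : ∫ t : ℝ in (-T)..T, f (a + t * Complex.I) =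
      ∫ t : ℝ in (-T)..T, g (a + t * Complex.I) := intervalIntegral.integral_congr fun x hx =>
    h _ (left_mem_rectBoundary (Set.uIcc_of_le hTT ▸ hx))
  rw [rectIntegral, rectIntegral, e1, e2, e3, e4]

/-- The four sides of a contour are parametrized by integrable functions. -/
lemma ContinuousOn.rect_intervalIntegrable {G : Type*} [NormedAddCommGroup G] (hab : a ≤ b)
    (hT : 0 ≤ T) {f : ℂ → G}
    (h : ContinuousOn f (rectBoundary a b T)) :
    IntervalIntegrable (fun x : ℝ => f (x + (-T : ℝ) * Complex.I)) volume a b ∧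
    IntervalIntegrable (fun x : ℝ => f (x + (T : ℝ) * Complex.I)) volume a b ∧
    IntervalIntegrable (fun t : ℝ => f (b + t * Complex.I)) volume (-T) T ∧
    IntervalIntegrable (fun t : ℝ => f (a + t * Complex.I)) volume (-T) T := by
  have hTT : -T ≤ T := by linarith
  refine ⟨?_, ?_, ?_, ?_⟩ <;> apply ContinuousOn.intervalIntegrable
  · exact h.comp (by fun_prop) fun x hx => lower_mem_rectBoundary hT (Set.uIcc_of_le hab ▸ hx)
  · exact h.comp (by fun_prop) fun x hx => upper_mem_rectBoundary hT (Set.uIcc_of_le hab ▸ hx)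
  · exact h.comp (by fun_prop) fun x hx => right_mem_rectBoundary (Set.uIcc_of_le hTT ▸ hx)
  · exact h.comp (by fun_prop) fun x hx => left_mem_rectBoundary (Set.uIcc_of_le hTT ▸ hx)

lemma rectIntegral_add (hab : a ≤ b) (hT : 0 ≤ T) {f g : ℂ → E}
    (hf : ContinuousOn f (rectBoundary a b T)) (hg : ContinuousOn g (rectBoundary a b T)) :
    rectIntegral a b T (fun z => f z + g z) = rectIntegral a b T f + rectIntegral a b T g := by
  obtain ⟨f1, f2, f3, f4⟩ := hf.rect_intervalIntegrable hab hT
  obtain ⟨g1, g2, g3, g4⟩ := hg.rect_intervalIntegrable hab hT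
  unfold rectIntegral
  rw [intervalIntegral.integral_add f1 g1, intervalIntegral.integral_add f2 g2,
    intervalIntegral.integral_add f3 g3, intervalIntegral.integral_add f4 g4, ← smul_add]
  congr 1
  rw [smul_add, smul_add]
  abel

lemma rectIntegral_map [CompleteSpace E] [CompleteSpace F] (J : E →L[ℂ] F) (hab : a ≤ b)
    (hT : 0 ≤ T) {f : ℂ → E} (hf : ContinuousOn f (rectBoundary a b T)) :
    rectIntegral a b T (fun z => J (f z)) = J (rectIntegral a b T f) := by
  obtain ⟨f1, f2, f3, f4⟩ := hf.rect_intervalIntegrable hab hT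
  unfold rectIntegral
  rw [J.intervalIntegral_comp_comm f1, J.intervalIntegral_comp_comm f2,
    J.intervalIntegral_comp_comm f3, J.intervalIntegral_comp_comm f4]
  simp only [map_smul, map_add, map_sub]

/-- Two sides of each kind and the factor `1 / (2π) ≤ 1 / 2`. The vertical bound is independent of
`T`. -/
lemma norm_rectIntegral_le (hab : a ≤ b) (hT : 0 ≤ T) {f : ℂ → E} {H : ℝ} {v : ℝ → ℝ}
    (hv : Integrable v) (hv0 : ∀ t, 0 ≤ v t)
    (hH : ∀ z : ℂ, z.re ∈ Set.Icc a b → |z.im| = T → ‖f z‖ ≤ H)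
    (hV : ∀ z : ℂ, z.re = a ∨ z.re = b → ‖f z‖ ≤ v z.im) :
    ‖rectIntegral a b T f‖ ≤ H * (b - a) + ∫ t, v t := by
  have hTT : -T ≤ T := by linarith
  have n1 : ‖∫ x : ℝ in a..b, f (x + (-T : ℝ) * Complex.I)‖ ≤ H * (b - a) := by
    have := intervalIntegral.norm_integral_le_of_norm_le_const (a := a) (b := b) (C := H)
      (f := fun x : ℝ => f (x + (-T : ℝ) * Complex.I)) fun x hx => by
        rw [Set.uIoc_of_le hab] at hx
        exact hH _ (by simpa using Set.Ioc_subset_Icc_self hx) (by simp [abs_of_nonneg hT])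
    rwa [abs_of_nonneg (sub_nonneg.2 hab)] at this
  have n2 : ‖∫ x : ℝ in a..b, f (x + (T : ℝ) * Complex.I)‖ ≤ H * (b - a) := by
    have := intervalIntegral.norm_integral_le_of_norm_le_const (a := a) (b := b) (C := H)
      (f := fun x : ℝ => f (x + (T : ℝ) * Complex.I)) fun x hx => by
        rw [Set.uIoc_of_le hab] at hx
        exact hH _ (by simpa using Set.Ioc_subset_Icc_self hx) (by simp [abs_of_nonneg hT])
    rwa [abs_of_nonneg (sub_nonneg.2 hab)] at this
  have hvT : ∫ t in (-T)..T, v t ≤ ∫ t, v t := by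
    rw [intervalIntegral.integral_of_le hTT]
    exact setIntegral_le_integral hv (ae_of_all _ hv0)
  have n3 : ‖∫ t : ℝ in (-T)..T, f (b + t * Complex.I)‖ ≤ ∫ t, v t :=
    (intervalIntegral.norm_integral_le_of_norm_le hTT
      (ae_of_all _ fun t _ => by simpa using hV (b + t * Complex.I) (by simp))
      hv.intervalIntegrable).trans hvT
  have n4 : ‖∫ t : ℝ in (-T)..T, f (a + t * Complex.I)‖ ≤ ∫ t, v t :=
    (intervalIntegral.norm_integral_le_of_norm_le hTT
      (ae_of_all _ fun t _ => by simpa using hV (a + t * Complex.I) (by simp))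
      hv.intervalIntegrable).trans hvT
  have hsum : ‖((∫ x : ℝ in a..b, f (x + (-T : ℝ) * Complex.I)) -
      (∫ x : ℝ in a..b, f (x + (T : ℝ) * Complex.I)) +
      Complex.I • (∫ t : ℝ in (-T)..T, f (b + t * Complex.I)) -
      Complex.I • (∫ t : ℝ in (-T)..T, f (a + t * Complex.I)))‖ ≤
      2 * (H * (b - a) + ∫ t, v t) := by
    have k3 := n3
    have k4 := n4
    rw [← one_mul (‖∫ t : ℝ in (-T)..T, f (b + t * Complex.I)‖), ← Complex.norm_I,
      ← norm_smul] at k3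
    rw [← one_mul (‖∫ t : ℝ in (-T)..T, f (a + t * Complex.I)‖), ← Complex.norm_I,
      ← norm_smul] at k4
    have := (norm_sub_le _ _).trans (add_le_add ((norm_add_le _ _).trans
      (add_le_add ((norm_sub_le _ _).trans (add_le_add n1 n2)) k3)) k4)
    linarith
  have hc : ‖(2 * Real.pi * Complex.I : ℂ)⁻¹‖ ≤ 1 / 2 := by
    rw [norm_inv, norm_mul, norm_mul, Complex.norm_I, Complex.norm_ofNat, Complex.norm_real,
      Real.norm_of_nonneg Real.pi_pos.le, mul_one, one_div]
    exact inv_anti₀ (by norm_num) (by linarith [Real.pi_gt_three])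
  unfold rectIntegral
  rw [norm_smul]
  refine (mul_le_mul hc hsum (norm_nonneg _) (by norm_num)).trans (le_of_eq ?_)
  ring

/-- Cauchy's theorem in the two rectangles between the heights `T` and `T'`, above and below the
real axis. Nothing is assumed inside the contour, where the spectrum lies. -/
theorem rectIntegral_eq_of_differentiableOn [CompleteSpace E] {f : ℂ → E}
    {D : Set ℂ} (hf : DifferentiableOn ℂ f D) {T T' T₀ : ℝ} (hT : T₀ ≤ T)
    (hT' : T₀ ≤ T') (hv : ∀ z : ℂ, z.re = a ∨ z.re = b → z ∈ D)
    (hh : ∀ z : ℂ, T₀ ≤ |z.im| → z ∈ D) :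
    rectIntegral a b T f = rectIntegral a b T' f := by
  have hup := Complex.integral_boundary_rect_eq_zero_of_differentiableOn f ⟨a, T⟩ ⟨b, T'⟩
    (hf.mono fun z hz => hh z (by
      have : T₀ ≤ z.im := by
        have h := hz.2
        simp only [Set.mem_preimage, Set.mem_uIcc] at h
        rcases h with h | h <;> linarith [h.1]
      exact this.trans (le_abs_self _)))
  have hlow := Complex.integral_boundary_rect_eq_zero_of_differentiableOn f ⟨a, -T'⟩ ⟨b, -T⟩
    (hf.mono fun z hz => hh z (by
      have : T₀ ≤ -z.im := by
        have h := hz.2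
        simp only [Set.mem_preimage, Set.mem_uIcc] at h
        rcases h with h | h <;> linarith [h.2]
      exact this.trans (neg_le_abs _)))
  have hi : ∀ r : ℝ, r = a ∨ r = b → ∀ s t : ℝ,
      IntervalIntegrable (fun y : ℝ => f (r + y * Complex.I)) volume s t := by
    intro r hr s t
    apply Continuous.intervalIntegrable
    rw [← continuousOn_univ]
    exact hf.continuousOn.comp (by fun_prop) fun y _ => hv _ (by simpa using hr)
  have hadd : ∀ r : ℝ, r = a ∨ r = b →
      (∫ y : ℝ in (-T')..T', f (r + y * Complex.I)) =
        (∫ y : ℝ in (-T')..(-T), f (r + y * Complex.I)) +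
        (∫ y : ℝ in (-T)..T, f (r + y * Complex.I)) + ∫ y : ℝ in T..T', f (r + y * Complex.I) := by
    intro r hr
    rw [intervalIntegral.integral_add_adjacent_intervals (hi r hr _ _) (hi r hr _ _),
      intervalIntegral.integral_add_adjacent_intervals (hi r hr _ _) (hi r hr _ _)]
  simp only at hup hlow
  unfold rectIntegral
  rw [hadd a (Or.inl rfl), hadd b (Or.inr rfl)]
  congr 1
  rw [← sub_eq_zero]
  -- The difference of the two contour integrals is minus the sum of the integrals around the upper
  -- and lower rectangles.
  have h0 : ∀ u v : E, u = 0 → v = 0 → -u - v = 0 := by rintro u v rfl rfl; simp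
  rw [← h0 _ _ hup hlow]
  simp only [smul_add]
  abel

end Rectangle

/-! ### The contour, the maximum norm and the tail of the series -/

lemma frontier_contourRect_subset (τ₁ τ₂ : ℂ) (N : ℕ) (T : ℝ) :
    frontier (contourRect τ₁ τ₂ N T) ⊆
      rectBoundary (contourCentre τ₁ τ₂ - (N + 1)) (contourCentre τ₁ τ₂ + (N + 1)) T := by
  intro z hz
  set c := contourCentre τ₁ τ₂ with hc
  have c1 : Continuous fun z : ℂ => |z.re - c| := by fun_prop
  have c2 : Continuous fun z : ℂ => |z.im| := by fun_prop
  have hopen : IsOpen (contourRect τ₁ τ₂ N T) :=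
    (isOpen_lt c1 continuous_const).inter (isOpen_lt c2 continuous_const)
  rw [frontier, hopen.interior_eq] at hz
  have hclosed : IsClosed {z : ℂ | |z.re - c| ≤ N + 1 ∧ |z.im| ≤ T} :=
    (isClosed_le c1 continuous_const).inter (isClosed_le c2 continuous_const)
  have hsub : contourRect τ₁ τ₂ N T ⊆ {z : ℂ | |z.re - c| ≤ N + 1 ∧ |z.im| ≤ T} :=
    fun w hw => ⟨hw.1.le, hw.2.le⟩
  have h1 : z ∈ {z : ℂ | |z.re - c| ≤ N + 1 ∧ |z.im| ≤ T} := closure_minimal hsub hclosed hz.1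
  have h2 : ¬(|z.re - c| < N + 1 ∧ |z.im| < T) := hz.2
  have h3 := abs_le.1 h1.1
  by_cases h : |z.im| < T
  · right
    have h4 : |z.re - c| = N + 1 := le_antisymm h1.1 (not_lt.1 fun h' => h2 ⟨h', h⟩)
    refine ⟨?_, h.le⟩
    rcases eq_or_eq_neg_of_abs_eq h4 with h5 | h5
    · right; linarith
    · left; linarith
  · left
    exact ⟨⟨by linarith, by linarith⟩, le_antisymm h1.2 (not_lt.1 h)⟩

lemma diracSupNorm_add_le (u v : DiracL2) :
    diracSupNorm (u + v) ≤ diracSupNorm u + diracSupNorm v := by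
  have h := coeFn_add_apply u v
  refine max_le ?_ ?_
  · have e : (fun x => (u + v : DiracL2) x 0) =ᵐ[diracMeasure]
        (fun x => u x 0) + fun x => v x 0 := by
      filter_upwards [h] with x hx using hx 0
    rw [eLpNorm_congr_ae e]
    exact (eLpNorm_add_le (memLp_apply u 0).1 (memLp_apply v 0).1 le_top).trans
      (add_le_add (le_max_left _ _) (le_max_left _ _))
  · have e : (fun x => (u + v : DiracL2) x 1) =ᵐ[diracMeasure]
        (fun x => u x 1) + fun x => v x 1 := by
      filter_upwards [h] with x hx using hx 1
    rw [eLpNorm_congr_ae e]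
    exact (eLpNorm_add_le (memLp_apply u 1).1 (memLp_apply v 1).1 le_top).trans
      (add_le_add (le_max_right _ _) (le_max_right _ _))

lemma diracSupNorm_neg (u : DiracL2) : diracSupNorm (-u) = diracSupNorm u := by
  have h : ∀ᵐ x ∂diracMeasure, ∀ i, (-u : DiracL2) x i = -(u x i) := by
    filter_upwards [Lp.coeFn_neg u] with x hx i
    rw [hx]; simp
  have e : ∀ i, eLpNorm (fun x => (-u : DiracL2) x i) ⊤ diracMeasure =
      eLpNorm (fun x => u x i) ⊤ diracMeasure := by
    intro i
    rw [← eLpNorm_neg (f := fun x => u x i)]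
    exact eLpNorm_congr_ae (h.mono fun x hx => hx i)
  rw [diracSupNorm, e, e, diracSupNorm]

/-- The solution `(1 - K V)⁻¹ (K V)² K F` that represents the tail of the perturbation series. -/
def tailFun (A : Matrix (Fin 2) (Fin 4) ℂ) {P Q : ℝ → ℂ} (hP : MemLp P 2 diracMeasure)
    (hQ : MemLp Q 2 diracMeasure) (F : DiracL2) (lam : ℂ) : DiracC :=
  Ring.inverse (1 - kernelOp A hP hQ lam) ((kernelOp A hP hQ lam ^ 2) (freeOp A lam F))

lemma le_rpow_mul_rpow {w ε x : ℝ} (hw : 0 ≤ w) (h₁ : w ≤ ε) (h₂ : w ≤ x) :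
    w ≤ ε ^ (1 / 4 : ℝ) * x ^ (3 / 4 : ℝ) := by
  calc w = w ^ (1 / 4 : ℝ) * w ^ (3 / 4 : ℝ) := by
        rw [← Real.rpow_add_of_nonneg hw (by norm_num) (by norm_num)]
        norm_num
    _ ≤ ε ^ (1 / 4 : ℝ) * x ^ (3 / 4 : ℝ) :=
        mul_le_mul (Real.rpow_le_rpow hw h₁ (by norm_num)) (Real.rpow_le_rpow hw h₂ (by norm_num))
          (Real.rpow_nonneg hw _) (Real.rpow_nonneg (hw.trans h₁) _)

lemma isSolutionOperator_freeOp {A : Matrix (Fin 2) (Fin 4) ℂ} (hA : IsRegularBC A) {τ₁ τ₂ : ℂ}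
    (hτ : IsCharExponents A τ₁ τ₂)
    {lam : ℂ} (hl : lam ∈ freeRegion τ₁ τ₂) :
    IsSolutionOperator A lam (freeOp A lam) := by
  obtain ⟨C, -, h⟩ := exists_solutionOperator_bound hA hτ
  exact (h lam hl).1

lemma differentiableOn_freeOp {A : Matrix (Fin 2) (Fin 4) ℂ} (hA : IsRegularBC A) {τ₁ τ₂ : ℂ}
    (hτ : IsCharExponents A τ₁ τ₂) : DifferentiableOn ℂ (freeOp A) (freeRegion τ₁ τ₂) :=
  differentiableOn_of_resolvent_identity inclusionOp (freeOp A) _ fun _ hl _ hm =>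
    (isSolutionOperator_freeOp hA hτ hl).resolvent_identity (isSolutionOperator_freeOp hA hτ hm)

lemma differentiableOn_kernelOp {A : Matrix (Fin 2) (Fin 4) ℂ} (hA : IsRegularBC A) {τ₁ τ₂ : ℂ}
    (hτ : IsCharExponents A τ₁ τ₂) {P Q : ℝ → ℂ} (hP : MemLp P 2 diracMeasure)
    (hQ : MemLp Q 2 diracMeasure) :
    DifferentiableOn ℂ (kernelOp A hP hQ) (freeRegion τ₁ τ₂) :=
  (differentiableOn_freeOp hA hτ).clm_comp (differentiableOn_const _)

lemma differentiableOn_freeOp_apply {A : Matrix (Fin 2) (Fin 4) ℂ} (hA : IsRegularBC A) {τ₁ τ₂ : ℂ}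
    (hτ : IsCharExponents A τ₁ τ₂)
    (F : DiracL2) :
    DifferentiableOn ℂ (fun lam => freeOp A lam F) (freeRegion τ₁ τ₂) :=
  (differentiableOn_freeOp hA hτ).clm_apply (differentiableOn_const _)

lemma DifferentiableOn.inverse_one_sub {E : Type*} [NormedAddCommGroup E] [NormedSpace ℂ E]
    [CompleteSpace E] {W : ℂ → E →L[ℂ] E} {s : Set ℂ} (hd : DifferentiableOn ℂ W s)
    (hW : ∀ z ∈ s, IsUnit (1 - W z)) :
    DifferentiableOn ℂ (fun z => Ring.inverse (1 - W z)) s := by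
  intro z hz
  have h1 : DifferentiableWithinAt ℂ (fun z => 1 - W z) s z := (hd z hz).const_sub 1
  have h2 : DifferentiableAt ℂ Ring.inverse (1 - W z) := differentiableAt_inverse (hW z hz)
  exact DifferentiableAt.comp_differentiableWithinAt (f := fun z => 1 - W z) z h2 h1

lemma differentiableOn_tailFun {A : Matrix (Fin 2) (Fin 4) ℂ} (hA : IsRegularBC A) {τ₁ τ₂ : ℂ}
    (hτ : IsCharExponents A τ₁ τ₂) {P Q : ℝ → ℂ} (hP : MemLp P 2 diracMeasure)
    (hQ : MemLp Q 2 diracMeasure)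
    {s : Set ℂ} (hs : s ⊆ freeRegion τ₁ τ₂)
    (hW : ∀ lam ∈ s, IsUnit (1 - kernelOp A hP hQ lam)) (F : DiracL2) :
    DifferentiableOn ℂ (tailFun A hP hQ F) s :=
  (((differentiableOn_kernelOp hA hτ hP hQ).mono hs).inverse_one_sub hW).clm_apply
    ((((differentiableOn_kernelOp hA hτ hP hQ).mono hs).pow 2).clm_apply
      ((differentiableOn_freeOp_apply hA hτ F).mono hs))

/-- Three quarters of the decay `‖W²‖ = O((1 + |t|)⁻¹)` are kept and one quarter is traded for
smallness. With the exponent `1/2` from `K F` this leaves `3/4 + 1/2 = 5/4 > 1`. -/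
lemma exists_tailFun_bound {A : Matrix (Fin 2) (Fin 4) ℂ} (hA : IsRegularBC A) {τ₁ τ₂ : ℂ}
    (hτ : IsCharExponents A τ₁ τ₂) {P Q : ℝ → ℂ} (hP : MemLp P 2 diracMeasure)
    (hQ : MemLp Q 2 diracMeasure) : ∃ C : ℝ, 0 ≤ C ∧ ∀ lam ∈ freeRegion τ₁ τ₂, ∀ ε : ℝ, 0 < ε →
    ε ≤ 1 / 4 → ‖kernelOp A hP hQ lam * kernelOp A hP hQ lam‖ ≤ ε → ∀ F : DiracL2,
      ‖tailFun A hP hQ F lam‖ ≤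
        C * ‖F‖ * ε ^ (1 / 4 : ℝ) * (1 + ‖lam.im‖) ^ (-(5 / 4) : ℝ) := by
  obtain ⟨C, hC, hop⟩ := exists_solutionOperator_bound hA hτ
  set m := diracNorm P + diracNorm Q with hm
  have hm0 : 0 ≤ m := add_nonneg (diracNorm_nonneg _) (diracNorm_nonneg _)
  set c := √(Real.pi + 1) with hc
  set k := (C * c * m) ^ 2 with hk
  refine ⟨2 * (1 + C * c * m) * k ^ (3 / 4 : ℝ) * (C * c), by positivity, ?_⟩
  intro lam hl ε hε hε4 hW F
  obtain ⟨-, hKn⟩ := hop lam hl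
  set W := kernelOp A hP hQ lam with hWd
  set s := 1 + ‖lam.im‖ with hs
  have hs1 : 0 < s := by positivity
  have hdr : decayRate lam.im = c * s ^ (-(1 / 2) : ℝ) := by
    rw [decayRate, Real.sqrt_div (by positivity), ← hc, Real.rpow_neg hs1.le, ← Real.sqrt_eq_rpow,
      div_eq_mul_inv]
    rfl
  have hKF : ‖freeOp A lam F‖ ≤ C * c * s ^ (-(1 / 2) : ℝ) * ‖F‖ := by
    refine (freeOp A lam).le_of_opNorm_le (hKn.trans (le_of_eq ?_)) F
    rw [hdr]; ring
  have hWn : ‖W‖ ≤ C * c * m * s ^ (-(1 / 2) : ℝ) := by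
    refine (ContinuousLinearMap.opNorm_comp_le _ _).trans ?_
    refine (mul_le_mul hKn (norm_potentialOp_le hP hQ) (ContinuousLinearMap.opNorm_nonneg _)
      (mul_nonneg hC (decayRate_nonneg _))).trans (le_of_eq ?_)
    rw [hdr]; ring
  have hs2 : s ^ (-(1 / 2) : ℝ) ≤ 1 :=
    Real.rpow_le_one_of_one_le_of_nonpos (by rw [hs]; linarith [norm_nonneg lam.im]) (by norm_num)
  have hWn' : ‖W‖ ≤ C * c * m := hWn.trans (mul_le_of_le_one_right (by positivity) hs2)
  have hss : s ^ (-(1 / 2) : ℝ) * s ^ (-(1 / 2) : ℝ) = s ^ (-1 : ℝ) := by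
    rw [← Real.rpow_add hs1]; norm_num
  have hWW : ‖W * W‖ ≤ k * s ^ (-1 : ℝ) := by
    refine (ContinuousLinearMap.opNorm_comp_le _ _).trans ?_
    refine (mul_le_mul hWn hWn (ContinuousLinearMap.opNorm_nonneg _) (by positivity)).trans (le_of_eq ?_)
    rw [← hss, hk]; ring
  have hinterp : ‖W * W‖ ≤ ε ^ (1 / 4 : ℝ) * (k ^ (3 / 4 : ℝ) * s ^ (-(3 / 4) : ℝ)) := by
    have h2 : k ^ (3 / 4 : ℝ) * s ^ (-(3 / 4) : ℝ) = (k * s ^ (-1 : ℝ)) ^ (3 / 4 : ℝ) := by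
      rw [Real.mul_rpow (by positivity) (by positivity), ← Real.rpow_mul hs1.le]
      norm_num
    rw [h2]
    exact le_rpow_mul_rpow (ContinuousLinearMap.opNorm_nonneg _) hW hWW
  have hsum : s ^ (-(3 / 4) : ℝ) * s ^ (-(1 / 2) : ℝ) = s ^ (-(5 / 4) : ℝ) := by
    rw [← Real.rpow_add hs1]; norm_num
  have h1 := norm_inverse_one_sub_apply_le (hW.trans hε4) ((W ^ 2) (freeOp A lam F))
  have h2 : ‖(W ^ 2) (freeOp A lam F)‖ ≤
      ε ^ (1 / 4 : ℝ) * (k ^ (3 / 4 : ℝ) * s ^ (-(3 / 4) : ℝ)) *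
        (C * c * s ^ (-(1 / 2) : ℝ) * ‖F‖) := by
    rw [pow_two]
    exact (W * W).le_of_opNorm_le_of_le hinterp hKF
  refine h1.trans ?_
  calc 2 * (1 + ‖W‖) * ‖(W ^ 2) (freeOp A lam F)‖
      ≤ 2 * (1 + C * c * m) * (ε ^ (1 / 4 : ℝ) * (k ^ (3 / 4 : ℝ) * s ^ (-(3 / 4) : ℝ)) *
        (C * c * s ^ (-(1 / 2) : ℝ) * ‖F‖)) := by
        refine mul_le_mul ?_ h2 (norm_nonneg _) (by positivity)
        linarith
    _ = _ := by rw [← hsum]; ring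

lemma exists_contour_subset {A : Matrix (Fin 2) (Fin 4) ℂ} {τ₁ τ₂ : ℂ}
    (hτ : IsCharExponents A τ₁ τ₂) (ρ : ℝ) : ∃ (N₁ : ℕ) (T₁ : ℝ), 0 < T₁ ∧
    (∀ N : ℕ, Even N → N₁ ≤ N → ∀ z : ℂ, z.re = contourCentre τ₁ τ₂ - (N + 1) ∨
      z.re = contourCentre τ₁ τ₂ + (N + 1) → z ∈ freeRegion τ₁ τ₂ ∧ ρ ≤ ‖z‖) ∧
    (∀ z : ℂ, T₁ ≤ |z.im| → z ∈ freeRegion τ₁ τ₂ ∧ ρ ≤ ‖z‖) := by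
  set c := contourCentre τ₁ τ₂
  obtain ⟨N₁, hN₁⟩ := exists_nat_ge (ρ + |c|)
  -- The height exceeds both `|Im τ|` by at least one, as `mem_freeRegion_of_im` requires, and also
  -- exceeds `ρ`.
  refine ⟨N₁, |τ₁.im| + |τ₂.im| + |ρ| + 1, by positivity, ?_, ?_⟩
  · intro N hN hNN z hz
    have hNN' : (N₁ : ℝ) ≤ N := by exact_mod_cast hNN
    have habs : |z.re - c| = N + 1 := by
      have h0 : (0 : ℝ) ≤ (N : ℝ) + 1 := by positivity
      rcases hz with h | h <;> rw [h]
      · rw [sub_sub_cancel_left, abs_neg, abs_of_nonneg h0]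
      · rw [add_sub_cancel_left, abs_of_nonneg h0]
    refine ⟨mem_freeRegion_of_re hτ.2 hN habs, ?_⟩
    have h1 := Complex.abs_re_le_norm z
    have h2 := abs_sub z.re c
    linarith
  · intro z hz
    have h1 := Complex.abs_im_le_norm z
    have h2 := abs_nonneg τ₁.im
    have h3 := abs_nonneg τ₂.im
    have h4 := abs_nonneg ρ
    have h5 := le_abs_self ρ
    exact ⟨mem_freeRegion_of_im (by linarith) (by linarith), by linarith⟩

/-! ### Splitting of the resolvent and holomorphy -/

/-- The perturbative part of the resolvent set: there `‖(K V)²‖ ≤ 1 / 4`. -/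
def IsPerturbative (A : Matrix (Fin 2) (Fin 4) ℂ) {P Q : ℝ → ℂ} (hP : MemLp P 2 diracMeasure)
    (hQ : MemLp Q 2 diracMeasure) (lam : ℂ) : Prop :=
  IsSolutionOperator A lam (freeOp A lam) ∧
    ‖kernelOp A hP hQ lam * kernelOp A hP hQ lam‖ ≤ 1 / 4

section Perturbative

variable {A : Matrix (Fin 2) (Fin 4) ℂ} {P Q : ℝ → ℂ} {hP : MemLp P 2 diracMeasure}
  {hQ : MemLp Q 2 diracMeasure} {lam : ℂ}

lemma IsPerturbative.isDiracResolvent (h : IsPerturbative A hP hQ lam) :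
    IsDiracResolvent A P Q lam
      (inclusionOp.comp ((Ring.inverse (1 - kernelOp A hP hQ lam)).comp (freeOp A lam))) :=
  isDiracResolvent_of_isUnit hP hQ h.1 (isUnit_one_sub_of_norm_sq_le h.2)

lemma IsPerturbative.freeResolvent_apply (h : IsPerturbative A hP hQ lam) (F : DiracL2) :
    freeResolvent A lam F = inclusionOp (freeOp A lam F) := by
  rw [freeResolvent_eq h.1]
  rfl

lemma IsPerturbative.perturbTerm_one (h : IsPerturbative A hP hQ lam) (F : DiracL2) :
    perturbTerm A P Q lam 1 F = inclusionOp (kernelOp A hP hQ lam (freeOp A lam F)) := by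
  rw [perturbTerm_eq hP hQ h.1, pow_one]

lemma IsPerturbative.nonlinearTail_eq (h : IsPerturbative A hP hQ lam) (F : DiracL2) :
    nonlinearTail A P Q lam F = inclusionOp (tailFun A hP hQ F lam) :=
  (hasSum_perturbTerm hP hQ h.1 h.2 F).tsum_eq

lemma IsPerturbative.diracResolvent_apply (h : IsPerturbative A hP hQ lam) (F : DiracL2) :
    diracResolvent A P Q lam F =
      freeResolvent A lam F + (perturbTerm A P Q lam 1 F + nonlinearTail A P Q lam F) := by
  have hu := isUnit_one_sub_of_norm_sq_le h.2
  rw [diracResolvent_eq h.isDiracResolvent, h.freeResolvent_apply, h.perturbTerm_one,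
    h.nonlinearTail_eq, ← map_add, ← map_add]
  change inclusionOp (Ring.inverse (1 - kernelOp A hP hQ lam) (freeOp A lam F)) = _
  congr 1
  rw [tailFun]
  exact inverse_one_sub_expansion hu (freeOp A lam F)

end Perturbative

lemma differentiableOn_perturbation {A : Matrix (Fin 2) (Fin 4) ℂ} (hA : IsRegularBC A)
    {τ₁ τ₂ : ℂ} (hτ : IsCharExponents A τ₁ τ₂) {P Q : ℝ → ℂ} (hP : MemLp P 2 diracMeasure)
    (hQ : MemLp Q 2 diracMeasure) {D : Set ℂ} (hD : D ⊆ freeRegion τ₁ τ₂)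
    (hpert : ∀ z ∈ D, IsPerturbative A hP hQ z) (F : DiracL2) :
    DifferentiableOn ℂ (fun lam => freeResolvent A lam F) D ∧
    DifferentiableOn ℂ (fun lam => perturbTerm A P Q lam 1 F) D ∧
    DifferentiableOn ℂ (fun lam => nonlinearTail A P Q lam F) D ∧
    DifferentiableOn ℂ (fun lam => diracResolvent A P Q lam F) D := by
  have d0 : DifferentiableOn ℂ (fun lam => freeResolvent A lam F) D :=
    (inclusionOp.differentiable.comp_differentiableOn
      ((differentiableOn_freeOp_apply hA hτ F).mono hD)).congr
      fun z hz => (hpert z hz).freeResolvent_apply F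
  have d1 : DifferentiableOn ℂ (fun lam => perturbTerm A P Q lam 1 F) D :=
    (inclusionOp.differentiable.comp_differentiableOn
      (((differentiableOn_kernelOp hA hτ hP hQ).clm_apply
        (differentiableOn_freeOp_apply hA hτ F)).mono hD)).congr
      fun z hz => (hpert z hz).perturbTerm_one F
  have d2 : DifferentiableOn ℂ (fun lam => nonlinearTail A P Q lam F) D :=
    (inclusionOp.differentiable.comp_differentiableOn
      (differentiableOn_tailFun hA hτ hP hQ hD
        (fun z hz => isUnit_one_sub_of_norm_sq_le (hpert z hz).2) F)).congr
      fun z hz => (hpert z hz).nonlinearTail_eq F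
  exact ⟨d0, d1, d2, (d0.fun_add (d1.fun_add d2)).congr
    fun z hz => (hpert z hz).diracResolvent_apply F⟩

lemma integrable_decay : Integrable fun t : ℝ => (1 + ‖t‖) ^ (-(5 / 4) : ℝ) := by
  apply integrable_one_add_norm
  norm_num

/-- The contour integrals of the tail are small, uniformly in the height of the contour. -/
theorem exists_rectIntegral_tailFun_le {A : Matrix (Fin 2) (Fin 4) ℂ} (hA : IsRegularBC A)
    {τ₁ τ₂ : ℂ} (hτ : IsCharExponents A τ₁ τ₂) {P Q : ℝ → ℂ} (hP : MemLp P 2 diracMeasure)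
    (hQ : MemLp Q 2 diracMeasure) (F : DiracL2) {δ : ℝ} (hδ : 0 < δ) :
    ∃ N₁ : ℕ, ∀ N : ℕ, Even N → N₁ ≤ N → ∀ᶠ T : ℝ in atTop,
      ‖rectIntegral (contourCentre τ₁ τ₂ - (N + 1)) (contourCentre τ₁ τ₂ + (N + 1)) T
        (tailFun A hP hQ F)‖ ≤ δ := by
  obtain ⟨C, hC, hb⟩ := exists_tailFun_bound hA hτ hP hQ
  set I := ∫ t : ℝ, (1 + ‖t‖) ^ (-(5 / 4) : ℝ) with hI
  have hI0 : 0 ≤ I := integral_nonneg fun t => by positivity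
  set M := C * ‖F‖ with hM
  have hM0 : 0 ≤ M := by positivity
  -- The vertical sides then contribute at most `M η I ≤ δ / 2`.
  set η := δ / (2 * (M * I + 1)) with hη
  have hη0 : 0 < η := by positivity
  set ε := min (1 / 4) (η ^ 4) with hε
  have hε0 : 0 < ε := lt_min (by norm_num) (by positivity)
  have hεη : ε ^ (1 / 4 : ℝ) ≤ η := by
    calc ε ^ (1 / 4 : ℝ) ≤ (η ^ 4) ^ (1 / 4 : ℝ) :=
          Real.rpow_le_rpow hε0.le (min_le_right _ _) (by norm_num)
      _ = η := by
          rw [← Real.rpow_natCast, ← Real.rpow_mul hη0.le]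
          norm_num
  obtain ⟨ρ, hρ⟩ := kernelOp_sq_small hA hτ hP hQ hε0
  obtain ⟨N₁, T₁, hT₁, hvert, hhor⟩ := exists_contour_subset hτ ρ
  have hbound : ∀ z : ℂ, z ∈ freeRegion τ₁ τ₂ ∧ ρ ≤ ‖z‖ →
      ‖tailFun A hP hQ F z‖ ≤ M * η * (1 + ‖z.im‖) ^ (-(5 / 4) : ℝ) := by
    rintro z ⟨hz, hzρ⟩
    refine (hb z hz ε hε0 (min_le_left _ _) (hρ z hz hzρ) F).trans ?_
    gcongr
  refine ⟨N₁, fun N hN hNN => ?_⟩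
  -- For fixed `N` the horizontal sides have fixed length, so they contribute less than `δ / 2` for
  -- large `T`. How large depends on `N`, hence the order of the quantifiers.
  have hlim : Tendsto (fun T : ℝ => M * η * T ^ (-(5 / 4) : ℝ) * (2 * (N + 1))) atTop (𝓝 0) := by
    have := ((tendsto_rpow_neg_atTop (y := 5 / 4) (by norm_num)).const_mul (M * η)).mul_const
      (2 * ((N : ℝ) + 1))
    simpa using this
  filter_upwards [hlim.eventually (gt_mem_nhds (half_pos hδ)), eventually_ge_atTop T₁]
    with T hT hTT
  have hT0 : 0 < T := hT₁.trans_le hTT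
  have hab : contourCentre τ₁ τ₂ - (N + 1) ≤ contourCentre τ₁ τ₂ + (N + 1) := by
    have : (0 : ℝ) ≤ N := Nat.cast_nonneg N
    linarith
  refine (norm_rectIntegral_le hab hT0.le (integrable_decay.const_mul (M * η))
    (fun t => by positivity) (H := M * η * T ^ (-(5 / 4) : ℝ)) ?_ ?_).trans ?_
  · intro z _ hz
    refine (hbound z (hhor z (hz ▸ hTT))).trans ?_
    rw [Real.norm_eq_abs, hz]
    have : (1 + T) ^ (-(5 / 4) : ℝ) ≤ T ^ (-(5 / 4) : ℝ) :=
      Real.rpow_le_rpow_of_nonpos hT0 (by linarith) (by norm_num)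
    gcongr
  · intro z hz
    exact hbound z (hvert N hN hNN z hz)
  · rw [integral_const_mul, ← hI]
    have h1 : M * η * I ≤ δ / 2 := by
      rw [show M * η * I = M * I * δ / (2 * (M * I + 1)) by rw [hη]; ring,
        div_le_div_iff₀ (by positivity) (by norm_num)]
      nlinarith [mul_nonneg hM0 hI0]
    rw [show contourCentre τ₁ τ₂ + ((N : ℝ) + 1) - (contourCentre τ₁ τ₂ - (N + 1)) =
      2 * (N + 1) by ring]
    linarith

end

/-! ### The main theorem -/

theorem proposition1 (A : Matrix (Fin 2) (Fin 4) ℂ) (hA : IsRegularBC A)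
    (P Q : ℝ → ℂ) (hP : MemLp P 2 diracMeasure) (hQ : MemLp Q 2 diracMeasure)
    (τ₁ τ₂ : ℂ) (hτ : IsCharExponents A τ₁ τ₂) :
    ∃ (N₀ : ℕ) (T₀ : ℝ), 0 < T₀ ∧
      -- the objects are well defined on the contour
      (∀ N : ℕ, Even N → N₀ ≤ N → ∀ T : ℝ, T₀ ≤ T →
        frontier (contourRect τ₁ τ₂ N T) ⊆ diracResolventSet A 0 0 ∩ diracResolventSet A P Q ∧
        ∀ F : DiracL2,
          (∀ lam ∈ frontier (contourRect τ₁ τ₂ N T),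
            Summable (fun m : ℕ => perturbTerm A P Q lam (m + 2) F)) ∧
          ContinuousOn (fun lam => diracResolvent A P Q lam F)
            (frontier (contourRect τ₁ τ₂ N T)) ∧
          ContinuousOn (fun lam => freeResolvent A lam F)
            (frontier (contourRect τ₁ τ₂ N T)) ∧
          ContinuousOn (fun lam => perturbTerm A P Q lam 1 F)
            (frontier (contourRect τ₁ τ₂ N T)) ∧
          ContinuousOn (fun lam => nonlinearTail A P Q lam F)
            (frontier (contourRect τ₁ τ₂ N T)) ∧
          partialSum A P Q τ₁ τ₂ N T F - partialSum A 0 0 τ₁ τ₂ N T F =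
            linearPart A P Q τ₁ τ₂ N T F + nonlinearPart A P Q τ₁ τ₂ N T F) ∧
      -- they do not depend on the height of the contour
      (∀ N : ℕ, Even N → N₀ ≤ N → ∀ T T' : ℝ, T₀ ≤ T → T₀ ≤ T' → ∀ F : DiracL2,
        partialSum A P Q τ₁ τ₂ N T F = partialSum A P Q τ₁ τ₂ N T' F ∧
        partialSum A 0 0 τ₁ τ₂ N T F = partialSum A 0 0 τ₁ τ₂ N T' F ∧
        linearPart A P Q τ₁ τ₂ N T F = linearPart A P Q τ₁ τ₂ N T' F ∧
        nonlinearPart A P Q τ₁ τ₂ N T F = nonlinearPart A P Q τ₁ τ₂ N T' F) ∧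
      -- the nonlinear part tends to zero, and equiconvergence is governed by the linear part
      (∀ T : ℝ, T₀ ≤ T → ∀ F : DiracL2,
        Tendsto (fun n : ℕ => diracSupNorm (nonlinearPart A P Q τ₁ τ₂ (2 * n) T F))
          atTop (𝓝 0) ∧
        (Tendsto (fun n : ℕ => diracSupNorm
            (partialSum A P Q τ₁ τ₂ (2 * n) T F - partialSum A 0 0 τ₁ τ₂ (2 * n) T F))
            atTop (𝓝 0) ↔
          Tendsto (fun n : ℕ => diracSupNorm (linearPart A P Q τ₁ τ₂ (2 * n) T F))
            atTop (𝓝 0))) := by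
  obtain ⟨ρ, hρ⟩ := kernelOp_sq_small hA hτ hP hQ (ε := 1 / 4) (by norm_num)
  obtain ⟨N₀, T₀, hT₀, hvert, hhor⟩ := exists_contour_subset hτ ρ
  -- All integrands are holomorphic on `D` (`hdiff`), and `D` contains the vertical lines through
  -- the sides and everything above and below height `T₀`.
  set D : Set ℂ := {z | z ∈ freeRegion τ₁ τ₂ ∧ ρ ≤ ‖z‖} with hD
  have hDs : D ⊆ freeRegion τ₁ τ₂ := fun z hz => hz.1
  have hpert : ∀ z ∈ D, IsPerturbative A hP hQ z := fun z hz =>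
    ⟨isSolutionOperator_freeOp hA hτ hz.1, hρ z hz.1 hz.2⟩
  have hab : ∀ N : ℕ, contourCentre τ₁ τ₂ - ((N : ℝ) + 1) ≤ contourCentre τ₁ τ₂ + (N + 1) := by
    intro N
    have : (0 : ℝ) ≤ N := Nat.cast_nonneg N
    linarith
  have hbd : ∀ N : ℕ, Even N → N₀ ≤ N → ∀ T : ℝ, T₀ ≤ T →
      rectBoundary (contourCentre τ₁ τ₂ - (N + 1)) (contourCentre τ₁ τ₂ + (N + 1)) T ⊆ D := by
    rintro N hN hNN T hT z (hz | hz)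
    · exact hhor z (hz.2 ▸ hT)
    · exact hvert N hN hNN z hz.1
  have hdiff := differentiableOn_perturbation hA hτ hP hQ hDs hpert
  have hsplit : ∀ N : ℕ, Even N → N₀ ≤ N → ∀ T : ℝ, T₀ ≤ T → ∀ F : DiracL2,
      partialSum A P Q τ₁ τ₂ N T F - partialSum A 0 0 τ₁ τ₂ N T F =
        linearPart A P Q τ₁ τ₂ N T F + nonlinearPart A P Q τ₁ τ₂ N T F := by
    intro N hN hNN T hT F
    have hs := hbd N hN hNN T hT
    have hT' : 0 ≤ T := hT₀.le.trans hT
    obtain ⟨d0, d1, d2, -⟩ := hdiff F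
    have c0 := d0.continuousOn.mono hs
    have c1 := d1.continuousOn.mono hs
    have c2 := d2.continuousOn.mono hs
    rw [sub_eq_iff_eq_add']
    simp only [partialSum, linearPart, nonlinearPart, contourIntegral_eq_rectIntegral]
    rw [← rectIntegral_add (hab N) hT' c1 c2]
    -- The integrand of `S⁰_N` is the free resolvent by definition.
    change _ = rectIntegral _ _ T (fun lam => freeResolvent A lam F) + _
    refine Eq.trans ?_ (rectIntegral_add (hab N) hT' c0 (c1.add c2))
    exact rectIntegral_congr (hab N) hT' fun z hz => (hpert z (hs hz)).diracResolvent_apply F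
  have hindep : ∀ N : ℕ, Even N → N₀ ≤ N → ∀ T T' : ℝ, T₀ ≤ T → T₀ ≤ T' →
      ∀ f : ℂ → DiracL2, DifferentiableOn ℂ f D →
        contourIntegral τ₁ τ₂ N T f = contourIntegral τ₁ τ₂ N T' f := by
    intro N hN hNN T T' hT hT' f hf
    rw [contourIntegral_eq_rectIntegral, contourIntegral_eq_rectIntegral]
    exact rectIntegral_eq_of_differentiableOn hf hT hT' (hvert N hN hNN) hhor
  refine ⟨N₀, T₀, hT₀, ?_, ?_, ?_⟩
  · intro N hN hNN T hT
    have hfr : frontier (contourRect τ₁ τ₂ N T) ⊆ D :=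
      (frontier_contourRect_subset τ₁ τ₂ N T).trans (hbd N hN hNN T hT)
    refine ⟨fun z hz => ?_, fun F => ?_⟩
    · have h := hpert z (hfr hz)
      exact ⟨⟨_, isDiracResolvent_free h.1⟩, ⟨_, h.isDiracResolvent⟩⟩
    · obtain ⟨d0, d1, d2, d3⟩ := hdiff F
      exact ⟨fun z hz => (hasSum_perturbTerm hP hQ (hpert z (hfr hz)).1
          (hpert z (hfr hz)).2 F).summable,
        d3.continuousOn.mono hfr, d0.continuousOn.mono hfr, d1.continuousOn.mono hfr,
        d2.continuousOn.mono hfr, hsplit N hN hNN T hT F⟩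
  · intro N hN hNN T T' hT hT' F
    obtain ⟨d0, d1, d2, d3⟩ := hdiff F
    have h := hindep N hN hNN T T' hT hT'
    exact ⟨h _ d3, h _ d0, h _ d1, h _ d2⟩
  · intro T hT F
    have hB : Tendsto (fun n : ℕ => diracSupNorm (nonlinearPart A P Q τ₁ τ₂ (2 * n) T F))
        atTop (𝓝 0) := by
      rw [ENNReal.tendsto_nhds_zero]
      intro e he
      obtain ⟨δ, hδ0, hδe⟩ : ∃ δ : ℝ, 0 < δ ∧ ENNReal.ofReal δ ≤ e := by
        obtain ⟨r, hr0, hre⟩ := ENNReal.lt_iff_exists_real_btwn.1 he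
        exact ⟨r, by simpa using hre.1, hre.2.le⟩
      obtain ⟨N₁, hN₁⟩ := exists_rectIntegral_tailFun_le hA hτ hP hQ F hδ0
      filter_upwards [eventually_ge_atTop (max N₀ N₁)] with n hn
      have hN : Even (2 * n) := even_two_mul n
      have hn0 : N₀ ≤ 2 * n := by have := le_max_left N₀ N₁; omega
      have hn1 : N₁ ≤ 2 * n := by have := le_max_right N₀ N₁; omega
      -- The given height `T` is replaced by a larger one depending on `n`, where the bound is
      -- available; the integral is unchanged.
      obtain ⟨T', hT', hT'0⟩ := ((hN₁ _ hN hn1).and (eventually_ge_atTop T₀)).exists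
      have hs := hbd _ hN hn0 T' hT'0
      have ht : ContinuousOn (tailFun A hP hQ F) (rectBoundary _ _ T') :=
        ((differentiableOn_tailFun hA hτ hP hQ hDs
          (fun z hz => isUnit_one_sub_of_norm_sq_le (hpert z hz).2) F).continuousOn).mono hs
      -- The integral is taken in the space of continuous pairs before the inclusion is applied, so
      -- its norm there bounds the maximum norm.
      have e1 : nonlinearPart A P Q τ₁ τ₂ (2 * n) T F = inclusionOp
          (rectIntegral (contourCentre τ₁ τ₂ - ((2 * n : ℕ) + 1))
            (contourCentre τ₁ τ₂ + ((2 * n : ℕ) + 1)) T' (tailFun A hP hQ F)) := by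
        rw [← rectIntegral_map inclusionOp (hab _) (hT₀.le.trans hT'0) ht, nonlinearPart,
          hindep _ hN hn0 T T' hT hT'0 _ (hdiff F).2.2.1, contourIntegral_eq_rectIntegral]
        exact rectIntegral_congr (hab _) (hT₀.le.trans hT'0)
          fun z hz => (hpert z (hs hz)).nonlinearTail_eq F
      rw [e1]
      exact (diracSupNorm_inclusionOp_le _).trans ((ENNReal.ofReal_le_ofReal hT').trans hδe)
    refine ⟨hB, ?_⟩
    have hev : ∀ᶠ n : ℕ in atTop,
        partialSum A P Q τ₁ τ₂ (2 * n) T F - partialSum A 0 0 τ₁ τ₂ (2 * n) T F =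
          linearPart A P Q τ₁ τ₂ (2 * n) T F + nonlinearPart A P Q τ₁ τ₂ (2 * n) T F := by
      filter_upwards [eventually_ge_atTop N₀] with n hn
      exact hsplit _ (even_two_mul n) (by omega) T hT F
    constructor
    · intro h
      have hsum := h.add hB
      rw [add_zero] at hsum
      refine tendsto_of_tendsto_of_tendsto_of_le_of_le' tendsto_const_nhds hsum
        (Eventually.of_forall fun _ => zero_le) ?_
      filter_upwards [hev] with n hn
      have e1 : linearPart A P Q τ₁ τ₂ (2 * n) T F =
          (partialSum A P Q τ₁ τ₂ (2 * n) T F - partialSum A 0 0 τ₁ τ₂ (2 * n) T F) +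
            -nonlinearPart A P Q τ₁ τ₂ (2 * n) T F := by rw [hn]; abel
      rw [e1]
      refine (diracSupNorm_add_le _ _).trans ?_
      rw [diracSupNorm_neg]
    · intro h
      have hsum := h.add hB
      rw [add_zero] at hsum
      refine tendsto_of_tendsto_of_tendsto_of_le_of_le' tendsto_const_nhds hsum
        (Eventually.of_forall fun _ => zero_le) ?_
      filter_upwards [hev] with n hn
      rw [hn]
      exact diracSupNorm_add_le _ _
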